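/- Graphs here are finite directed graphs in which parallel edges and loops are allowed, with a label from $\{\bullet,\square,\Diamond\}$ on every node and a label from $\{t,f,\square\}$ on every edge; below, an arrow $x\to y$ without a label is a $\square$-labelled edge, and $x\xrightarrow{t}y$, $x\xrightarrow{f}y$ are edges labelled $t$, $f$. Rules $\langle L\leftarrow K\rightarrow R\rangle$ are applied by the double-pushout construction with injective matches satisfying the dangling condition: for an injective, label-preserving morphism $g\colon L\to G$ such that no edge of $G$ outside $g(L)$ is incident to a node of $g(L\setminus K)$, delete $g(L\setminus K)$ and add $R\setminus K$ disjointly. Results are taken up to isomorphism. For a set $\mathcal R$ of rules, $G\Rightarrow_{\mathcal R}H$ is a single rule application, and $G\Rightarrow^*_{\mathcal R}H$ means $G\cong H$ or one or more applications. The inverse of $\langle L\leftarrow K\rightarrow R\rangle$ is $\langle R\leftarrow K\rightarrow L\rangle$, and $\mathcal R^{-1}$ is the set of the inverses. The grammar $EFD$ of extended flow diagrams has no non-terminal labels, the start graph $S=(\bullet\to\square\to\bullet)$, and the set $\mathcal R$ of the following five rules, written $L\Rightarrow R$; the numbered nodes are the nodes of the interface $K$, which has no edges. - seq: $\bullet_1\to\square_2\to\bullet_3\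 \Rightarrow\ \bullet_1\to\square_2\to\bullet\to\square\to\bullet_3$; - while: $\bullet_1\to\square\to\bullet_2\ \Rightarrow\ \bullet_1\to\Diamond$, $\Diamond\xrightarrow{t}\bullet_1$, $\Diamond\xrightarrow{f}\bullet_2$; - ddec: $\bullet_1\to\square\to\bullet_2\ \Rightarrow\ \bullet_1\to\Diamond$, $\Diamond\xrightarrow{t}\bullet_2$, $\Diamond\xrightarrow{f}\bullet_2$; - dec1: $\Diamond_1\xrightarrow{t}\bullet_2\ \Rightarrow\ \Diamond_1\xrightarrow{t}\bullet\to\square\to\bullet_2$; - dec2: $\Diamond_1\xrightarrow{f}\bullet_2\ \Rightarrow\ \Diamond_1\xrightarrow{f}\bullet\to\square\to\bullet_2$. Let $L(EFD)=\{[G] : S\Rightarrow^*_{\mathcal R}G\}$ be the set of isomorphism classes of graphs that it generates. Theorem (Efficient EFD Recognition). The system $EFD^{-1}$ with the rules $\mathcal R^{-1}$ efficiently recognises $L(EFD)$, that is: 1. (recognition) there is a graph $S'$ with $[S']\in L(EFD)$ such that for every graph $G$: $[G]\in L(EFD)$ if and only if $G\Rightarrow^*_{\mathcal R^{-1}}S'$;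 2. (termination) there is no infinite sequence $G_0\Rightarrow_{\mathcal R^{-1}}G_1\Rightarrow_{\mathcal R^{-1}}G_2\Rightarrow_{\mathcal R^{-1}}\cdots$ of graphs; 3. (confluence on the language) whenever $[G]\in L(EFD)$, $G\Rightarrow^*_{\mathcal R^{-1}}H_1$ and $G\Rightarrow^*_{\mathcal R^{-1}}H_2$, there is a graph $M$ with $H_1\Rightarrow^*_{\mathcal R^{-1}}M$ and $H_2\Rightarrow^*_{\mathcal R^{-1}}M$. -/

import Mathlib

/-- A finite directed graph with parallel edges and loops, totally labelled by node labels from `A`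
and edge labels from `B`. -/
structure LGraph (A B : Type) where
  V : Type
  E : Type
  finV : Finite V
  finE : Finite E
  src : E → V
  tgt : E → V
  nodeLabel : V → A
  edgeLabel : E → B

namespace LGraph

variable {A B : Type}

/-- Label preserving graph morphisms. -/
structure Hom (G H : LGraph A B) where
  onV : G.V → H.V
  onE : G.E → H.E
  map_src : ∀ e, onV (G.src e) = H.src (onE e)
  map_tgt : ∀ e, onV (G.tgt e) = H.tgt (onE e)
  map_edgeLabel : ∀ e, G.edgeLabel e = H.edgeLabel (onE e)
  map_nodeLabel : ∀ v, G.nodeLabel v = H.nodeLabel (onV v)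

namespace Hom

def id (G : LGraph A B) : Hom G G :=
  ⟨fun v => v, fun e => e, fun _ => rfl, fun _ => rfl, fun _ => rfl, fun _ => rfl⟩

def comp {G H J : LGraph A B} (g : Hom H J) (f : Hom G H) : Hom G J where
  onV := fun v => g.onV (f.onV v)
  onE := fun e => g.onE (f.onE e)
  map_src := fun e => by rw [f.map_src, g.map_src]
  map_tgt := fun e => by rw [f.map_tgt, g.map_tgt]
  map_edgeLabel := fun e => by rw [f.map_edgeLabel, g.map_edgeLabel]
  map_nodeLabel := fun v => by rw [f.map_nodeLabel, g.map_nodeLabel]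

def Injective {G H : LGraph A B} (f : Hom G H) : Prop :=
  Function.Injective f.onV ∧ Function.Injective f.onE

def Bijective {G H : LGraph A B} (f : Hom G H) : Prop :=
  Function.Bijective f.onV ∧ Function.Bijective f.onE

/-- The inverse of a bijective morphism. -/
noncomputable def inverse {G H : LGraph A B} (f : Hom G H) (hf : f.Bijective) : Hom H G where
  onV := (Equiv.ofBijective f.onV hf.1).symm
  onE := (Equiv.ofBijective f.onE hf.2).symm
  map_src := fun e => by
    rw [Equiv.symm_apply_eq]
    change _ = f.onV _
    rw [f.map_src]
    exact congrArg H.src ((Equiv.ofBijective f.onE hf.2).apply_symm_apply e).symm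
  map_tgt := fun e => by
    rw [Equiv.symm_apply_eq]
    change _ = f.onV _
    rw [f.map_tgt]
    exact congrArg H.tgt ((Equiv.ofBijective f.onE hf.2).apply_symm_apply e).symm
  map_edgeLabel := fun e => by
    rw [f.map_edgeLabel]
    exact congrArg H.edgeLabel ((Equiv.ofBijective f.onE hf.2).apply_symm_apply e).symm
  map_nodeLabel := fun v => by
    rw [f.map_nodeLabel]
    exact congrArg H.nodeLabel ((Equiv.ofBijective f.onV hf.1).apply_symm_apply v).symm

end Hom

def Iso (G H : LGraph A B) : Prop := ∃ f : Hom G H, f.Bijective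

theorem iso_refl (G : LGraph A B) : Iso G G :=
  ⟨Hom.id G, Function.bijective_id, Function.bijective_id⟩

theorem iso_symm {G H : LGraph A B} (h : Iso G H) : Iso H G := by
  obtain ⟨f, hf⟩ := h
  exact ⟨f.inverse hf, Equiv.bijective _, Equiv.bijective _⟩

theorem iso_trans {G H J : LGraph A B} (h₁ : Iso G H) (h₂ : Iso H J) : Iso G J := by
  obtain ⟨f, hf⟩ := h₁
  obtain ⟨g, hg⟩ := h₂
  exact ⟨g.comp f, hg.1.comp hf.1, hg.2.comp hf.2⟩

instance isoSetoid (A B : Type) : Setoid (LGraph A B) :=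
  ⟨Iso, iso_refl, iso_symm, iso_trans⟩

end LGraph

/-- Abstract graphs: isomorphism classes of graphs. -/
def AbstractGraph (A B : Type) : Type 1 := Quotient (LGraph.isoSetoid A B)

/-- The abstract graph `[G]`. -/
def LGraph.cls {A B : Type} (G : LGraph A B) : AbstractGraph A B :=
  Quotient.mk (LGraph.isoSetoid A B) G

/-- A rule `L ← K → R`; the (injective) morphisms exhibit the interface `K` as a subgraph of both
`L` and `R`. -/
structure GRule (A B : Type) where
  L : LGraph A B
  K : LGraph A B
  R : LGraph A B
  left : LGraph.Hom K L
  right : LGraph.Hom K R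
  left_inj : left.Injective
  right_inj : right.Injective

namespace GRule

variable {A B : Type}

/-- The inverse rule `R ← K → L`. -/
def inv (r : GRule A B) : GRule A B :=
  ⟨r.R, r.K, r.L, r.right, r.left, r.right_inj, r.left_inj⟩

/-- The square with sides `k : K → L`, `d : K → D`, `g : L → G`, `i : D → G` shows `G` as the graph
obtained by gluing `L` and `D` along `K` (a pushout along injective morphisms): it commutes,
`g` and `i` are injective, every node and edge of `G` comes from `L` or `D`, and a node or edge of
`L` is identified with one of `D` only if both come from the same node or edge of `K`. -/
structure IsGluing {K L D G : LGraph A B} (k : LGraph.Hom K L) (d : LGraph.Hom K D)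
    (g : LGraph.Hom L G) (i : LGraph.Hom D G) : Prop where
  comm : g.comp k = i.comp d
  inj_g : g.Injective
  inj_i : i.Injective
  coverV : ∀ v : G.V, (∃ x, g.onV x = v) ∨ (∃ y, i.onV y = v)
  coverE : ∀ e : G.E, (∃ x, g.onE x = e) ∨ (∃ y, i.onE y = e)
  overlapV : ∀ x y, g.onV x = i.onV y → ∃ z, k.onV z = x ∧ d.onV z = y
  overlapE : ∀ x y, g.onE x = i.onE y → ∃ z, k.onE z = x ∧ d.onE z = y

/-- `G ⇒ H` by the rule `r`: a double pushout with an injective match `g : L → G`. The graph `D` is,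
up to isomorphism, `G` with `g(L ∖ K)` deleted (it exists exactly if the dangling condition holds: no
edge outside `g(L)` touches a node of `g(L ∖ K)`), and `H` is, up to isomorphism, `D` with `R ∖ K`
added. -/
def DirectDerives (r : GRule A B) (G H : LGraph A B) : Prop :=
  ∃ (D : LGraph A B) (g : LGraph.Hom r.L G) (d : LGraph.Hom r.K D) (h : LGraph.Hom r.R H)
    (i : LGraph.Hom D G) (j : LGraph.Hom D H),
    IsGluing r.left d g i ∧ IsGluing r.right d h j

end GRule

/-- A graph transformation system over the label alphabet `(A, B)`. -/
structure GTSystem (A B : Type) where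
  rules : Set (GRule A B)
  finite_rules : rules.Finite

namespace GTSystem

variable {A B : Type}

/-- The system of all inverse rules. -/
def inverse (T : GTSystem A B) : GTSystem A B :=
  ⟨GRule.inv '' T.rules, T.finite_rules.image _⟩

/-- `G ⇒ H`. -/
def Step (T : GTSystem A B) (G H : LGraph A B) : Prop :=
  ∃ r ∈ T.rules, r.DirectDerives G H

/-- `G ⇒* H`: isomorphism, or one or more direct derivations. -/
def Derives (T : GTSystem A B) (G H : LGraph A B) : Prop :=
  LGraph.Iso G H ∨ Relation.TransGen T.Step G H

def Joinable (T : GTSystem A B) (G H : LGraph A B) : Prop :=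
  ∃ M, T.Derives G M ∧ T.Derives H M

def Terminating (T : GTSystem A B) : Prop :=
  ¬ ∃ f : ℕ → LGraph A B, ∀ n, T.Step (f n) (f (n + 1))

/-- Confluence on a set of abstract graphs (confluence up to garbage). -/
def ConfluentOn (T : GTSystem A B) (D : Set (AbstractGraph A B)) : Prop :=
  ∀ G H₁ H₂ : LGraph A B, G.cls ∈ D → T.Derives G H₁ → T.Derives G H₂ → T.Joinable H₁ H₂

end GTSystem

/-- A subalphabet of `(A, B)`. -/
structure SubAlphabet (A B : Type) where
  nodes : Set A
  edges : Set B

/-- All labels of `G` are in the subalphabet. -/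
def LGraph.Over {A B : Type} (G : LGraph A B) (P : SubAlphabet A B) : Prop :=
  (∀ v, G.nodeLabel v ∈ P.nodes) ∧ (∀ e, G.edgeLabel e ∈ P.edges)

/-- `T` recognises the language `L` over `P`. -/
def GTSystem.Recognises {A B : Type} (T : GTSystem A B) (P : SubAlphabet A B)
    (L : Set (AbstractGraph A B)) : Prop :=
  ∃ S : LGraph A B, S.cls ∈ L ∧ ∀ G : LGraph A B, G.Over P → (G.cls ∈ L ↔ T.Derives G S)

/-- `T` efficiently recognises the language `L` over `P`. -/
def GTSystem.EfficientlyRecognises {A B : Type} (T : GTSystem A B) (P : SubAlphabet A B)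
    (L : Set (AbstractGraph A B)) : Prop :=
  T.Recognises P L ∧ T.Terminating ∧ T.ConfluentOn L

/-- A graph grammar: a system, a subalphabet of non-terminals, and a start graph. -/
structure GraphGrammar (A B : Type) where
  system : GTSystem A B
  nonterminals : SubAlphabet A B
  start : LGraph A B

namespace GraphGrammar

variable {A B : Type}

/-- The labels that are not non-terminals. -/
def terminals (𝒢 : GraphGrammar A B) : SubAlphabet A B :=
  ⟨(𝒢.nonterminals.nodes)ᶜ, (𝒢.nonterminals.edges)ᶜ⟩

/-- The language generated by a grammar. -/
def language (𝒢 : GraphGrammar A B) : Set (AbstractGraph A B) :=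
  {X | ∃ G : LGraph A B, 𝒢.system.Derives 𝒢.start G ∧ G.Over 𝒢.terminals ∧ X = G.cls}

end GraphGrammar

namespace EFD

/-- Node labels: program points `•`, statements `□`, decisions `◇`. -/
inductive NodeLabel
  | point
  | stmt
  | decision
  deriving DecidableEq

/-- Edge labels: `t`, `f`, and `□` (the label of the edges that are drawn without a label). -/
inductive EdgeLabel
  | t
  | f
  | blank
  deriving DecidableEq

open NodeLabel EdgeLabel

/-- The graph with nodes `0, …, n - 1`, node labels `lab`, and edges listed as
(source, label, target). -/
def graph {n m : ℕ} (lab : Fin n → NodeLabel) (edge : Fin m → Fin n × EdgeLabel × Fin n) :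
    LGraph NodeLabel EdgeLabel where
  V := Fin n
  E := Fin m
  finV := inferInstance
  finE := inferInstance
  src := fun e => (edge e).1
  tgt := fun e => (edge e).2.2
  nodeLabel := lab
  edgeLabel := fun e => (edge e).2.1

/-- The rule with the given left and right graphs whose interface consists of `k` nodes and no edges;
the `i`-th interface node is the node `l i` on the left and the node `r i` on the right. -/
def rule {n m n' m' k : ℕ} (lab : Fin n → NodeLabel) (edge : Fin m → Fin n × EdgeLabel × Fin n)
    (lab' : Fin n' → NodeLabel) (edge' : Fin m' → Fin n' × EdgeLabel × Fin n')
    (l : Fin k → Fin n) (r : Fin k → Fin n') (hl : Function.Injective l)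
    (hr : Function.Injective r) (hlab : ∀ i, lab (l i) = lab' (r i)) :
    GRule NodeLabel EdgeLabel where
  L := graph lab edge
  K := graph (m := 0) (fun i => lab (l i)) Fin.elim0
  R := graph lab' edge'
  left := ⟨l, Fin.elim0, fun e => e.elim0, fun e => e.elim0, fun e => e.elim0, fun _ => rfl⟩
  right := ⟨r, Fin.elim0, fun e => e.elim0, fun e => e.elim0, fun e => e.elim0, hlab⟩
  left_inj := ⟨hl, fun e => e.elim0⟩
  right_inj := ⟨hr, fun e => e.elim0⟩

/-- `•₀ → □₁ → •₂  ⇒  •₀ → □₁ → •₃ → □₄ → •₂`, with interface nodes `0, 1, 2`. -/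
def seq : GRule NodeLabel EdgeLabel :=
  rule (n := 3) (m := 2) (n' := 5) (m' := 4) (k := 3)
    ![point, stmt, point] ![(0, blank, 1), (1, blank, 2)]
    ![point, stmt, point, point, stmt]
    ![(0, blank, 1), (1, blank, 3), (3, blank, 4), (4, blank, 2)]
    ![0, 1, 2] ![0, 1, 2] (by decide) (by decide) (by decide)

/-- `•₀ → □ → •₂  ⇒  •₀ → ◇`, `◇ -t→ •₀`, `◇ -f→ •₂`, with interface nodes `0, 2`. -/
def whileLoop : GRule NodeLabel EdgeLabel :=
  rule (n := 3) (m := 2) (n' := 3) (m' := 3) (k := 2)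
    ![point, stmt, point] ![(0, blank, 1), (1, blank, 2)]
    ![point, decision, point] ![(0, blank, 1), (1, t, 0), (1, f, 2)]
    ![0, 2] ![0, 2] (by decide) (by decide) (by decide)

/-- `•₀ → □ → •₂  ⇒  •₀ → ◇`, `◇ -t→ •₂`, `◇ -f→ •₂`, with interface nodes `0, 2`. -/
def ddec : GRule NodeLabel EdgeLabel :=
  rule (n := 3) (m := 2) (n' := 3) (m' := 3) (k := 2)
    ![point, stmt, point] ![(0, blank, 1), (1, blank, 2)]
    ![point, decision, point] ![(0, blank, 1), (1, t, 2), (1, f, 2)]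
    ![0, 2] ![0, 2] (by decide) (by decide) (by decide)

/-- `◇₀ -t→ •₁  ⇒  ◇₀ -t→ •₂ → □₃ → •₁`, with interface nodes `0, 1`. -/
def dec1 : GRule NodeLabel EdgeLabel :=
  rule (n := 2) (m := 1) (n' := 4) (m' := 3) (k := 2)
    ![decision, point] ![(0, t, 1)]
    ![decision, point, point, stmt] ![(0, t, 2), (2, blank, 3), (3, blank, 1)]
    ![0, 1] ![0, 1] (by decide) (by decide) (by decide)

/-- `◇₀ -f→ •₁  ⇒  ◇₀ -f→ •₂ → □₃ → •₁`, with interface nodes `0, 1`. -/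
def dec2 : GRule NodeLabel EdgeLabel :=
  rule (n := 2) (m := 1) (n' := 4) (m' := 3) (k := 2)
    ![decision, point] ![(0, f, 1)]
    ![decision, point, point, stmt] ![(0, f, 2), (2, blank, 3), (3, blank, 1)]
    ![0, 1] ![0, 1] (by decide) (by decide) (by decide)

/-- The rules of the grammar. -/
def system : GTSystem NodeLabel EdgeLabel :=
  ⟨{seq, whileLoop, ddec, dec1, dec2}, by simp⟩

/-- The grammar of extended flow diagrams; there are no non-terminals and the start graph is
`• → □ → •`. -/
def grammar : GraphGrammar NodeLabel EdgeLabel where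
  system := system
  nonterminals := ⟨∅, ∅⟩
  start := graph (n := 3) (m := 2) ![point, stmt, point] ![(0, blank, 1), (1, blank, 2)]

end EFD

/-! The rules are read as edits of control-flow programs. A program is a map `s : ℕ → Cmd`: a live
point is an exit, or carries a statement with one successor, or a decision with a `t`- and an
`f`-successor; `enc` turns it into a graph. A match into such a graph is forced once its first node
is placed, and the inverse rules become two operations. Undoing `seq`, `dec1` or `dec2` removes a
statement point with exactly one incoming reference and redirects that reference to its successor
(`bypass`). Undoing `whileLoop` or `ddec` turns a decision whose `t`-branch returns to itself, or
agrees with its `f`-branch, into a statement (`collapse`).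

The invariant `Good` asks for finitely many points, no reference to a dead point, and a path from
every point to an exit. The start graph represents a good program and the forward rules keep this
property (`Represents.step`), so every graph of the language is represented; the converse is not
needed. Goodness excludes cycles of two statements, which are what could prevent two bypasses from
commuting, and reductions of good programs then have the diamond property (`Red.diamond`). Since
points keep their names, the diamond closes with equal programs and not just isomorphic ones.
Church–Rosser gives confluence of programs; `Represents.inverse_step` and `inverse_step_of_red`
carry it to graphs.

The other two claims are short. There are no non-terminals, so reversing derivations gives
recognition with the start graph as target. Each inverse rule has more edges on its left than on its
right and an interface without edges, so the number of edges falls at every step. -/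

namespace LGraph

variable {A B : Type}

namespace Hom

@[ext]
theorem ext' {G H : LGraph A B} {f g : Hom G H} (hV : ∀ v, f.onV v = g.onV v)
    (hE : ∀ e, f.onE e = g.onE e) : f = g := by
  obtain ⟨fV, fE, _, _, _, _⟩ := f
  obtain ⟨gV, gE, _, _, _, _⟩ := g
  obtain rfl : fV = gV := funext hV
  obtain rfl : fE = gE := funext hE
  rfl

end Hom

end LGraph

/-! ### Gluings, and uniqueness of the result for a given match -/

namespace GRule

open LGraph

variable {A B : Type}

namespace IsGluing

variable {K L D G : LGraph A B} {k : Hom K L} {d : Hom K D} {g : Hom L G} {i : Hom D G}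

theorem commV (h : IsGluing k d g i) (z : K.V) : g.onV (k.onV z) = i.onV (d.onV z) :=
  congrArg (fun f : Hom K G => f.onV z) h.comm

theorem commE (h : IsGluing k d g i) (z : K.E) : g.onE (k.onE z) = i.onE (d.onE z) :=
  congrArg (fun f : Hom K G => f.onE z) h.comm

theorem trans_iso (h : IsGluing k d g i) {G' : LGraph A B} (f : Hom G G') (hf : f.Bijective) :
    IsGluing k d (f.comp g) (f.comp i) where
  comm := by
    ext z
    · exact congrArg f.onV (h.commV z)
    · exact congrArg f.onE (h.commE z)
  inj_g := ⟨hf.1.1.comp h.inj_g.1, hf.2.1.comp h.inj_g.2⟩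
  inj_i := ⟨hf.1.1.comp h.inj_i.1, hf.2.1.comp h.inj_i.2⟩
  coverV v := by
    obtain ⟨v, rfl⟩ := hf.1.2 v
    rcases h.coverV v with ⟨x, rfl⟩ | ⟨x, rfl⟩
    · exact Or.inl ⟨x, rfl⟩
    · exact Or.inr ⟨x, rfl⟩
  coverE v := by
    obtain ⟨v, rfl⟩ := hf.2.2 v
    rcases h.coverE v with ⟨x, rfl⟩ | ⟨x, rfl⟩
    · exact Or.inl ⟨x, rfl⟩
    · exact Or.inr ⟨x, rfl⟩
  overlapV x y hxy := h.overlapV x y (hf.1.1 hxy)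
  overlapE x y hxy := h.overlapE x y (hf.2.1 hxy)

/-- The dangling condition. -/
theorem dangling (h : IsGluing k d g i) (e : G.E) (he : ∀ x, g.onE x ≠ e) (x : L.V)
    (hx : g.onV x = G.src e ∨ g.onV x = G.tgt e) : ∃ z, k.onV z = x := by
  obtain ⟨y, rfl⟩ : ∃ y, i.onE y = e := (h.coverE e).resolve_left fun ⟨x, hx⟩ => he x hx
  rw [← i.map_src, ← i.map_tgt] at hx
  rcases hx with hx | hx
  · obtain ⟨z, hz, -⟩ := h.overlapV _ _ hx
    exact ⟨z, hz⟩
  · obtain ⟨z, hz, -⟩ := h.overlapV _ _ hx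
    exact ⟨z, hz⟩

/-- The pushout complement maps into any other one. -/
theorem exists_hom_complement {D' : LGraph A B} {d' : Hom K D'} {i' : Hom D' G}
    (h : IsGluing k d g i) (h' : IsGluing k d' g i') :
    ∃ f : Hom D D', i'.comp f = i ∧ f.comp d = d' := by
  have hV : ∀ y, ∃ y', i'.onV y' = i.onV y := by
    intro y
    rcases h'.coverV (i.onV y) with ⟨x, hx⟩ | hy
    · obtain ⟨z, rfl, rfl⟩ := h.overlapV _ _ hx
      exact ⟨d'.onV z, by rw [← h.commV, h'.commV]⟩
    · exact hy
  have hE : ∀ y, ∃ y', i'.onE y' = i.onE y := by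
    intro y
    rcases h'.coverE (i.onE y) with ⟨x, hx⟩ | hy
    · obtain ⟨z, rfl, rfl⟩ := h.overlapE _ _ hx
      exact ⟨d'.onE z, by rw [← h.commE, h'.commE]⟩
    · exact hy
  choose fV hfV using hV
  choose fE hfE using hE
  refine ⟨⟨fV, fE, fun e => h'.inj_i.1 ?_, fun e => h'.inj_i.1 ?_, fun e => ?_, fun v => ?_⟩,
    ?_, ?_⟩
  · rw [hfV, i'.map_src, hfE, i.map_src]
  · rw [hfV, i'.map_tgt, hfE, i.map_tgt]
  · rw [i'.map_edgeLabel, hfE, i.map_edgeLabel]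
  · rw [i'.map_nodeLabel, hfV, i.map_nodeLabel]
  · ext v
    · exact hfV v
    · exact hfE v
  · ext v
    · exact h'.inj_i.1 ((hfV _).trans ((h.commV v).symm.trans (h'.commV v)))
    · exact h'.inj_i.2 ((hfE _).trans ((h.commE v).symm.trans (h'.commE v)))

/-- The universal property of a gluing. -/
theorem exists_desc {X : LGraph A B} (h : IsGluing k d g i) (p : Hom L X) (q : Hom D X)
    (hpq : p.comp k = q.comp d) : ∃ f : Hom G X, f.comp g = p ∧ f.comp i = q := by
  have hpqV : ∀ z, p.onV (k.onV z) = q.onV (d.onV z) := fun z =>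
    congrArg (fun f : Hom K X => f.onV z) hpq
  have hpqE : ∀ z, p.onE (k.onE z) = q.onE (d.onE z) := fun z =>
    congrArg (fun f : Hom K X => f.onE z) hpq
  have hV : ∀ v, ∃ w, (∀ x, g.onV x = v → p.onV x = w) ∧ (∀ y, i.onV y = v → q.onV y = w) := by
    intro v
    rcases h.coverV v with ⟨x, rfl⟩ | ⟨y, rfl⟩
    · refine ⟨p.onV x, fun x' hx' => by rw [h.inj_g.1 hx'], fun y hy => ?_⟩
      obtain ⟨z, rfl, rfl⟩ := h.overlapV _ _ hy.symm
      exact (hpqV z).symm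
    · refine ⟨q.onV y, fun x hx => ?_, fun y' hy' => by rw [h.inj_i.1 hy']⟩
      obtain ⟨z, rfl, rfl⟩ := h.overlapV _ _ hx
      exact hpqV z
  have hE : ∀ v, ∃ w, (∀ x, g.onE x = v → p.onE x = w) ∧ (∀ y, i.onE y = v → q.onE y = w) := by
    intro v
    rcases h.coverE v with ⟨x, rfl⟩ | ⟨y, rfl⟩
    · refine ⟨p.onE x, fun x' hx' => by rw [h.inj_g.2 hx'], fun y hy => ?_⟩
      obtain ⟨z, rfl, rfl⟩ := h.overlapE _ _ hy.symm
      exact (hpqE z).symm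
    · refine ⟨q.onE y, fun x hx => ?_, fun y' hy' => by rw [h.inj_i.2 hy']⟩
      obtain ⟨z, rfl, rfl⟩ := h.overlapE _ _ hx
      exact hpqE z
  choose fV hpV hqV using hV
  choose fE hpE hqE using hE
  refine ⟨⟨fV, fE, fun e => ?_, fun e => ?_, fun e => ?_, fun v => ?_⟩, ?_, ?_⟩
  · rcases h.coverE e with ⟨x, rfl⟩ | ⟨y, rfl⟩
    · rw [← hpE _ x rfl, ← p.map_src, ← g.map_src, ← hpV _ _ rfl]
    · rw [← hqE _ y rfl, ← q.map_src, ← i.map_src, ← hqV _ _ rfl]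
  · rcases h.coverE e with ⟨x, rfl⟩ | ⟨y, rfl⟩
    · rw [← hpE _ x rfl, ← p.map_tgt, ← g.map_tgt, ← hpV _ _ rfl]
    · rw [← hqE _ y rfl, ← q.map_tgt, ← i.map_tgt, ← hqV _ _ rfl]
  · rcases h.coverE e with ⟨x, rfl⟩ | ⟨y, rfl⟩
    · rw [← hpE _ x rfl, ← p.map_edgeLabel, ← g.map_edgeLabel]
    · rw [← hqE _ y rfl, ← q.map_edgeLabel, ← i.map_edgeLabel]
  · rcases h.coverV v with ⟨x, rfl⟩ | ⟨y, rfl⟩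
    · rw [← hpV _ x rfl, ← p.map_nodeLabel, ← g.map_nodeLabel]
    · rw [← hqV _ y rfl, ← q.map_nodeLabel, ← i.map_nodeLabel]
  · ext v
    · exact (hpV _ v rfl).symm
    · exact (hpE _ v rfl).symm
  · ext v
    · exact (hqV _ v rfl).symm
    · exact (hqE _ v rfl).symm

theorem hom_ext {X : LGraph A B} (h : IsGluing k d g i) {f f' : Hom G X}
    (hg : f.comp g = f'.comp g) (hi : f.comp i = f'.comp i) : f = f' := by
  ext v
  · rcases h.coverV v with ⟨x, rfl⟩ | ⟨y, rfl⟩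
    · exact congrArg (fun f : Hom L X => f.onV x) hg
    · exact congrArg (fun f : Hom D X => f.onV y) hi
  · rcases h.coverE v with ⟨x, rfl⟩ | ⟨y, rfl⟩
    · exact congrArg (fun f : Hom L X => f.onE x) hg
    · exact congrArg (fun f : Hom D X => f.onE y) hi

end IsGluing

theorem bijective_of_comp_eq_id {G H : LGraph A B} {f : Hom G H} {f' : Hom H G}
    (h : f'.comp f = Hom.id G) (h' : f.comp f' = Hom.id H) : f.Bijective :=
  ⟨Function.bijective_iff_has_inverse.2 ⟨f'.onV, fun v => congrArg (fun f : Hom G G => f.onV v) h,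
    fun v => congrArg (fun f : Hom H H => f.onV v) h'⟩,
   Function.bijective_iff_has_inverse.2 ⟨f'.onE, fun v => congrArg (fun f : Hom G G => f.onE v) h,
    fun v => congrArg (fun f : Hom H H => f.onE v) h'⟩⟩

/-- The result of a direct derivation is determined by the match, up to isomorphism. -/
theorem iso_of_same_match {r : GRule A B} {G H H' D D' : LGraph A B} {g : Hom r.L G}
    {d : Hom r.K D} {i : Hom D G} {h : Hom r.R H} {j : Hom D H} {d' : Hom r.K D'} {i' : Hom D' G}
    {h' : Hom r.R H'} {j' : Hom D' H'} (h₁ : IsGluing r.left d g i) (h₂ : IsGluing r.right d h j)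
    (h₁' : IsGluing r.left d' g i') (h₂' : IsGluing r.right d' h' j') : Iso H H' := by
  obtain ⟨f, hf, hfd⟩ := h₁.exists_hom_complement h₁'
  obtain ⟨f', hf', hfd'⟩ := h₁'.exists_hom_complement h₁
  have hff : f'.comp f = Hom.id D := by
    ext v
    · apply h₁.inj_i.1
      change (i.comp f').onV (f.onV v) = _
      rw [hf']
      exact congrArg (fun f : Hom D G => f.onV v) hf
    · apply h₁.inj_i.2
      change (i.comp f').onE (f.onE v) = _
      rw [hf']
      exact congrArg (fun f : Hom D G => f.onE v) hf
  have hff' : f.comp f' = Hom.id D' := by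
    ext v
    · apply h₁'.inj_i.1
      change (i'.comp f).onV (f'.onV v) = _
      rw [hf]
      exact congrArg (fun f : Hom D' G => f.onV v) hf'
    · apply h₁'.inj_i.2
      change (i'.comp f).onE (f'.onE v) = _
      rw [hf]
      exact congrArg (fun f : Hom D' G => f.onE v) hf'
  obtain ⟨u, hu, hu'⟩ := h₂.exists_desc h' (j'.comp f)
    (by rw [h₂'.comm, ← hfd]; rfl)
  obtain ⟨w, hw, hw'⟩ := h₂'.exists_desc h (j.comp f')
    (by rw [h₂.comm, ← hfd']; rfl)
  refine ⟨u, bijective_of_comp_eq_id (f' := w) (h₂.hom_ext ?_ ?_) (h₂'.hom_ext ?_ ?_)⟩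
  · change w.comp (u.comp h) = h
    rw [hu, hw]
  · change w.comp (u.comp j) = j
    rw [hu']
    change (w.comp j').comp f = j
    rw [hw']
    change j.comp (f'.comp f) = j
    rw [hff]
    rfl
  · change u.comp (w.comp h') = h'
    rw [hw, hu]
  · change u.comp (w.comp j') = j'
    rw [hw']
    change (u.comp j).comp f' = j'
    rw [hu']
    change j'.comp (f.comp f') = j'
    rw [hff']
    rfl

theorem DirectDerives.congr_left {r : GRule A B} {G G' H : LGraph A B} (h : r.DirectDerives G H)
    (hG : Iso G G') : r.DirectDerives G' H := by
  obtain ⟨D, g, d, h, i, j, h₁, h₂⟩ := h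
  obtain ⟨f, hf⟩ := hG
  exact ⟨D, f.comp g, d, h, f.comp i, j, h₁.trans_iso f hf, h₂⟩

theorem DirectDerives.symm {r : GRule A B} {G H : LGraph A B} (h : r.DirectDerives G H) :
    r.inv.DirectDerives H G := by
  obtain ⟨D, g, d, h, i, j, h₁, h₂⟩ := h
  exact ⟨D, h, d, g, j, i, h₂, h₁⟩

theorem DirectDerives.congr_right {r : GRule A B} {G H H' : LGraph A B} (h : r.DirectDerives G H)
    (hH : Iso H H') : r.DirectDerives G H' :=
  (h.symm.congr_left hH).symm

/-- An interface without edges allows no edge of `L` to be identified with one of `D`, so the edge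
set of `G` is a disjoint union. -/
theorem IsGluing.card_edges {K L D G : LGraph A B} {k : Hom K L} {d : Hom K D} {g : Hom L G}
    {i : Hom D G} (h : IsGluing k d g i) [IsEmpty K.E] :
    Nat.card G.E = Nat.card L.E + Nat.card D.E := by
  have := L.finE
  have := D.finE
  rw [← Nat.card_sum]
  refine (Nat.card_eq_of_bijective (Sum.elim g.onE i.onE) ⟨?_, fun e => ?_⟩).symm
  · refine h.inj_g.2.sumElim h.inj_i.2 fun x y hxy => ?_
    obtain ⟨z, -⟩ := h.overlapE x y hxy
    exact isEmptyElim z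
  · rcases h.coverE e with ⟨x, hx⟩ | ⟨x, hx⟩
    · exact ⟨Sum.inl x, hx⟩
    · exact ⟨Sum.inr x, hx⟩

/-- Both pushouts share the context `D`, whose edges cancel. This is the termination measure. -/
theorem DirectDerives.card_edges_lt {r : GRule A B} [IsEmpty r.K.E] {G H : LGraph A B}
    (h : r.DirectDerives G H) (hr : Nat.card r.R.E < Nat.card r.L.E) :
    Nat.card H.E < Nat.card G.E := by
  obtain ⟨D, g, d, h, i, j, h₁, h₂⟩ := h
  rw [h₁.card_edges, h₂.card_edges]
  omega

end GRule

/-! ### Derivations up to isomorphism, inversion, recognition -/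

namespace GTSystem

open LGraph

variable {A B : Type} {T : GTSystem A B}

theorem Step.congr_left {G G' H : LGraph A B} (h : T.Step G H) (hG : Iso G G') : T.Step G' H := by
  obtain ⟨r, hr, h⟩ := h
  exact ⟨r, hr, h.congr_left hG⟩

theorem Step.congr_right {G H H' : LGraph A B} (h : T.Step G H) (hH : Iso H H') : T.Step G H' := by
  obtain ⟨r, hr, h⟩ := h
  exact ⟨r, hr, h.congr_right hH⟩

theorem step_inverse_iff {G H : LGraph A B} : T.inverse.Step G H ↔ T.Step H G := by
  constructor
  · rintro ⟨_, ⟨r, hr, rfl⟩, h⟩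
    exact ⟨r, hr, h.symm⟩
  · rintro ⟨r, hr, h⟩
    exact ⟨r.inv, ⟨r, hr, rfl⟩, h.symm⟩

theorem derives_inverse_iff {G H : LGraph A B} : T.inverse.Derives G H ↔ T.Derives H G := by
  refine or_congr ⟨iso_symm, iso_symm⟩ ?_
  have : T.inverse.Step = Function.swap T.Step := by
    ext G H
    exact step_inverse_iff
  rw [this, Relation.transGen_swap]

theorem Derives.congr_right {G H H' : LGraph A B} (h : T.Derives G H) (hH : Iso H H') :
    T.Derives G H' := by
  rcases h with h | h
  · exact Or.inl (iso_trans h hH)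
  · right
    cases h with
    | single h => exact .single (h.congr_right hH)
    | tail h h' => exact .tail h (h'.congr_right hH)

/-- Inverting the system exchanges the two ends of a derivation, so this reduces to
`Derives.congr_right`. -/
theorem Derives.congr_left {G G' H : LGraph A B} (h : T.Derives G H) (hG : Iso G G') :
    T.Derives G' H :=
  derives_inverse_iff.1 ((derives_inverse_iff.2 h).congr_right hG)

theorem Derives.tail {G H H' : LGraph A B} (h : T.Derives G H) (h' : T.Step H H') :
    T.Derives G H' := by
  rcases h with h | h
  · exact Or.inr (.single (h'.congr_left (iso_symm h)))
  · exact Or.inr (.tail h h')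

/-- Induction along a derivation, for properties of graphs that are invariant under isomorphism. -/
theorem Derives.preserves {P : LGraph A B → Prop} (hiso : ∀ G H, P G → Iso G H → P H)
    (hstep : ∀ G H, P G → T.Step G H → P H) {G H : LGraph A B} (h : T.Derives G H) (hG : P G) :
    P H := by
  rcases h with h | h
  · exact hiso _ _ hG h
  · induction h with
    | single h => exact hstep _ _ hG h
    | tail _ h ih => exact hstep _ _ ih h

end GTSystem

namespace GraphGrammar

open LGraph

variable {A B : Type} {𝒢 : GraphGrammar A B}

theorem cls_mem_language_iff (h : 𝒢.nonterminals = ⟨∅, ∅⟩) {G : LGraph A B} :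
    G.cls ∈ 𝒢.language ↔ 𝒢.system.Derives 𝒢.start G := by
  constructor
  · rintro ⟨G', hG', -, hG⟩
    exact hG'.congr_right (iso_symm (Quotient.exact hG))
  · intro hG
    refine ⟨G, hG, ⟨fun v => ?_, fun e => ?_⟩, rfl⟩ <;> simp [terminals, h]

/-- A grammar without nonterminals is recognised by its inverse system. -/
theorem recognises_inverse (h : 𝒢.nonterminals = ⟨∅, ∅⟩) :
    𝒢.system.inverse.Recognises 𝒢.terminals 𝒢.language :=
  ⟨𝒢.start, (cls_mem_language_iff h).2 (Or.inl (iso_refl _)), fun _ _ =>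
    (cls_mem_language_iff h).trans GTSystem.derives_inverse_iff.symm⟩

end GraphGrammar

/-! ### Rewriting of graphs with named nodes and edges -/

open LGraph

/-- A finite graph whose nodes and edges are sets of names from the types `ν` and `ε`. -/
structure Net (ν ε A B : Type) where
  nodes : Set ν
  edges : Set ε
  src : ε → ν
  tgt : ε → ν
  nodeLabel : ν → A
  edgeLabel : ε → B
  finite_nodes : nodes.Finite
  finite_edges : edges.Finite
  src_mem : ∀ e ∈ edges, src e ∈ nodes
  tgt_mem : ∀ e ∈ edges, tgt e ∈ nodes

namespace Net

variable {ν ε A B : Type}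

/-- The graph that a net describes. -/
def graph (N : Net ν ε A B) : LGraph A B where
  V := N.nodes
  E := N.edges
  finV := N.finite_nodes
  finE := N.finite_edges
  src := fun e => ⟨N.src e, N.src_mem e e.2⟩
  tgt := fun e => ⟨N.tgt e, N.tgt_mem e e.2⟩
  nodeLabel := fun v => N.nodeLabel v
  edgeLabel := fun e => N.edgeLabel e

/-- An injective morphism from a graph into a net. -/
structure Match (L : LGraph A B) (N : Net ν ε A B) where
  V : L.V → ν
  E : L.E → ε
  memV : ∀ x, V x ∈ N.nodes
  memE : ∀ e, E e ∈ N.edges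
  src : ∀ e, N.src (E e) = V (L.src e)
  tgt : ∀ e, N.tgt (E e) = V (L.tgt e)
  edgeLabel : ∀ e, N.edgeLabel (E e) = L.edgeLabel e
  nodeLabel : ∀ x, N.nodeLabel (V x) = L.nodeLabel x
  injV : Function.Injective V
  injE : Function.Injective E

namespace Match

def hom {L : LGraph A B} {N : Net ν ε A B} (g : Match L N) : Hom L N.graph where
  onV := fun x => ⟨g.V x, g.memV x⟩
  onE := fun e => ⟨g.E e, g.memE e⟩
  map_src := fun e => Subtype.ext (g.src e).symm
  map_tgt := fun e => Subtype.ext (g.tgt e).symm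
  map_edgeLabel := fun e => (g.edgeLabel e).symm
  map_nodeLabel := fun x => (g.nodeLabel x).symm

def ofHom {L : LGraph A B} {N : Net ν ε A B} (g : Hom L N.graph) (hg : g.Injective) :
    Match L N where
  V := fun x => (g.onV x).1
  E := fun e => (g.onE e).1
  memV := fun x => (g.onV x).2
  memE := fun e => (g.onE e).2
  src := fun e => congrArg Subtype.val (g.map_src e).symm
  tgt := fun e => congrArg Subtype.val (g.map_tgt e).symm
  edgeLabel := fun e => (g.map_edgeLabel e).symm
  nodeLabel := fun x => (g.map_nodeLabel x).symm
  injV := Subtype.val_injective.comp hg.1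
  injE := Subtype.val_injective.comp hg.2

theorem hom_injective {L : LGraph A B} {N : Net ν ε A B} (g : Match L N) : g.hom.Injective :=
  ⟨fun _ _ h => g.injV (congrArg Subtype.val h), fun _ _ h => g.injE (congrArg Subtype.val h)⟩

/-- A surjective match is an isomorphism. -/
theorem iso {L : LGraph A B} {N : Net ν ε A B} (g : Match L N) (hV : ∀ x ∈ N.nodes, ∃ y, g.V y = x)
    (hE : ∀ x ∈ N.edges, ∃ y, g.E y = x) : Iso L N.graph :=
  ⟨g.hom, ⟨g.hom_injective.1, fun v => (hV v.1 v.2).imp fun _ h => Subtype.ext h⟩,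
    ⟨g.hom_injective.2, fun e => (hE e.1 e.2).imp fun _ h => Subtype.ext h⟩⟩

end Match

/-- The dangling condition for a match into a net. -/
def Dangling {K L : LGraph A B} (k : Hom K L) {N : Net ν ε A B} (g : Match L N) : Prop :=
  ∀ e ∈ N.edges, (∀ x, g.E x ≠ e) → ∀ x, (g.V x = N.src e ∨ g.V x = N.tgt e) → ∃ z, k.onV z = x

/-- `N` and `N'` agree apart from the images of the two sides of the rule `r`. -/
structure Rewrites (r : GRule A B) {N N' : Net ν ε A B} (g : Match r.L N) (h : Match r.R N') :
    Prop where
  interface : ∀ z, g.V (r.left.onV z) = h.V (r.right.onV z)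
  nodes : ∀ x, (∀ y, g.V y ≠ x) → (∀ y, h.V y ≠ x) →
    (x ∈ N.nodes ↔ x ∈ N'.nodes) ∧ (x ∈ N.nodes → N.nodeLabel x = N'.nodeLabel x)
  node_left : ∀ y, (∀ y', h.V y' ≠ g.V y) → g.V y ∉ N'.nodes
  node_right : ∀ y, (∀ y', g.V y' ≠ h.V y) → h.V y ∉ N.nodes
  edges : ∀ e, (∀ y, g.E y ≠ e) → (∀ y, h.E y ≠ e) → (e ∈ N.edges ↔ e ∈ N'.edges) ∧
    (e ∈ N.edges → N.src e = N'.src e ∧ N.tgt e = N'.tgt e ∧ N.edgeLabel e = N'.edgeLabel e)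
  edge_left : ∀ y, (∀ y', h.E y' ≠ g.E y) → g.E y ∉ N'.edges
  edge_right : ∀ y, (∀ y', g.E y' ≠ h.E y) → h.E y ∉ N.edges

namespace Rewrites

variable {r : GRule A B} {N N' : Net ν ε A B} {g : Match r.L N} {h : Match r.R N'}

theorem symm (H : Rewrites r g h) : Rewrites r.inv h g where
  interface z := (H.interface z).symm
  nodes x hx hx' :=
    ⟨(H.nodes x hx' hx).1.symm, fun hN =>
      ((H.nodes x hx' hx).2 ((H.nodes x hx' hx).1.2 hN)).symm⟩
  node_left := H.node_right
  node_right := H.node_left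
  edges e he he' := by
    obtain ⟨h₁, h₂⟩ := H.edges e he' he
    refine ⟨h₁.symm, fun hN => ?_⟩
    obtain ⟨a, b, c⟩ := h₂ (h₁.2 hN)
    exact ⟨a.symm, b.symm, c.symm⟩
  edge_left := H.edge_right
  edge_right := H.edge_left

/-- The part of a net that remains when the image of `L ∖ K` is deleted. -/
def context {K L : LGraph A B} (k : Hom K L) (g : Match L N) (hg : Dangling k g) :
    Net ν ε A B where
  nodes := {x | x ∈ N.nodes ∧ ∀ y, g.V y = x → ∃ z, k.onV z = y}
  edges := {e | e ∈ N.edges ∧ ∀ y, g.E y ≠ e}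
  src := N.src
  tgt := N.tgt
  nodeLabel := N.nodeLabel
  edgeLabel := N.edgeLabel
  finite_nodes := N.finite_nodes.subset fun _ h => h.1
  finite_edges := N.finite_edges.subset fun _ h => h.1
  src_mem := fun e he => ⟨N.src_mem e he.1, fun y hy => hg e he.1 he.2 y (Or.inl hy)⟩
  tgt_mem := fun e he => ⟨N.tgt_mem e he.1, fun y hy => hg e he.1 he.2 y (Or.inr hy)⟩

/-- With common names for both graphs, the context of `N` is literally contained in `N'` as well, so
both legs of the double pushout are inclusions. The conditions on fresh and deleted names in
`Rewrites` ensure that the right-hand overlap consists of interface nodes only. -/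
theorem exists_gluing (H : Rewrites r g h) (hg : Dangling r.left g) [IsEmpty r.K.E] :
    ∃ (D : LGraph A B) (d : Hom r.K D) (i : Hom D N.graph) (j : Hom D N'.graph),
      GRule.IsGluing r.left d g.hom i ∧ GRule.IsGluing r.right d h.hom j := by
  have hnode : ∀ x ∈ (context r.left g hg).nodes,
      x ∈ N'.nodes ∧ N.nodeLabel x = N'.nodeLabel x := by
    rintro x ⟨hx, hx'⟩
    by_cases h₁ : ∃ y, g.V y = x
    · obtain ⟨y, rfl⟩ := h₁
      obtain ⟨z, rfl⟩ := hx' y rfl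
      rw [g.nodeLabel, ← r.left.map_nodeLabel, r.right.map_nodeLabel, ← h.nodeLabel, H.interface]
      exact ⟨h.memV _, rfl⟩
    · push Not at h₁
      by_cases h₂ : ∃ y, h.V y = x
      · obtain ⟨y, rfl⟩ := h₂
        exact absurd hx (H.node_right y h₁)
      · push Not at h₂
        have := H.nodes x h₁ h₂
        exact ⟨this.1.1 hx, this.2 hx⟩
  have hright : ∀ e ∈ (context r.left g hg).edges, ∀ y, h.E y ≠ e := by
    rintro e he y rfl
    exact H.edge_right y he.2 he.1
  have hedge : ∀ e ∈ (context r.left g hg).edges, e ∈ N'.edges ∧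
      N.src e = N'.src e ∧ N.tgt e = N'.tgt e ∧ N.edgeLabel e = N'.edgeLabel e := by
    intro e he
    have := H.edges e he.2 (hright e he)
    exact ⟨this.1.1 he.1, this.2 he.1⟩
  let d : Hom r.K (context r.left g hg).graph :=
    { onV := fun z => ⟨g.V (r.left.onV z), g.memV _, fun y hy => ⟨z, (g.injV hy).symm⟩⟩
      onE := isEmptyElim
      map_src := isEmptyElim
      map_tgt := isEmptyElim
      map_edgeLabel := isEmptyElim
      map_nodeLabel := fun z => (r.left.map_nodeLabel z).trans (g.nodeLabel _).symm }
  let i : Hom (context r.left g hg).graph N.graph :=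
    { onV := fun x => ⟨x.1, x.2.1⟩
      onE := fun e => ⟨e.1, e.2.1⟩
      map_src := fun _ => rfl
      map_tgt := fun _ => rfl
      map_edgeLabel := fun _ => rfl
      map_nodeLabel := fun _ => rfl }
  let j : Hom (context r.left g hg).graph N'.graph :=
    { onV := fun x => ⟨x.1, (hnode x.1 x.2).1⟩
      onE := fun e => ⟨e.1, (hedge e.1 e.2).1⟩
      map_src := fun e => Subtype.ext (hedge e.1 e.2).2.1
      map_tgt := fun e => Subtype.ext (hedge e.1 e.2).2.2.1
      map_edgeLabel := fun e => (hedge e.1 e.2).2.2.2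
      map_nodeLabel := fun x => (hnode x.1 x.2).2 }
  refine ⟨_, d, i, j, ⟨?_, g.hom_injective, ⟨?_, ?_⟩, ?_, ?_, ?_, ?_⟩,
    ⟨?_, h.hom_injective, ⟨?_, ?_⟩, ?_, ?_, ?_, ?_⟩⟩
  · ext z
    · rfl
    · exact isEmptyElim z
  · exact fun x y hxy => Subtype.ext (congrArg Subtype.val hxy :)
  · exact fun x y hxy => Subtype.ext (congrArg Subtype.val hxy :)
  · intro v
    by_cases hv : ∃ y, g.V y = v.1
    · exact Or.inl (hv.imp fun y hy => Subtype.ext hy)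
    · exact Or.inr ⟨⟨v.1, v.2, fun y hy => absurd ⟨y, hy⟩ hv⟩, rfl⟩
  · intro v
    by_cases hv : ∃ y, g.E y = v.1
    · exact Or.inl (hv.imp fun y hy => Subtype.ext hy)
    · exact Or.inr ⟨⟨v.1, v.2, fun y hy => absurd ⟨y, hy⟩ hv⟩, rfl⟩
  · intro x y hxy
    have hxy : g.V x = y.1 := congrArg Subtype.val hxy
    obtain ⟨z, rfl⟩ := y.2.2 x hxy
    exact ⟨z, rfl, Subtype.ext hxy⟩
  · intro x y hxy
    exact absurd (congrArg Subtype.val hxy) (y.2.2 x)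
  · ext z
    · exact Subtype.ext (H.interface z).symm
    · exact isEmptyElim z
  · exact fun x y hxy => Subtype.ext (congrArg Subtype.val hxy :)
  · exact fun x y hxy => Subtype.ext (congrArg Subtype.val hxy :)
  · intro v
    by_cases hv : ∃ y, h.V y = v.1
    · exact Or.inl (hv.imp fun y hy => Subtype.ext hy)
    · push Not at hv
      have hgv : ∀ y, g.V y ≠ v.1 := fun y hy =>
        H.node_left y (fun y' => by rw [hy]; exact hv y') (by rw [hy]; exact v.2)
      exact Or.inr ⟨⟨v.1, (H.nodes _ hgv hv).1.2 v.2, fun y hy => absurd hy (hgv y)⟩, rfl⟩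
  · intro v
    by_cases hv : ∃ y, h.E y = v.1
    · exact Or.inl (hv.imp fun y hy => Subtype.ext hy)
    · push Not at hv
      have hgv : ∀ y, g.E y ≠ v.1 := fun y hy =>
        H.edge_left y (fun y' => by rw [hy]; exact hv y') (by rw [hy]; exact v.2)
      exact Or.inr ⟨⟨v.1, (H.edges _ hgv hv).1.2 v.2, hgv⟩, rfl⟩
  · intro x y hxy
    have hxy : h.V x = y.1 := congrArg Subtype.val hxy
    by_cases hv : ∃ x', g.V x' = y.1
    · obtain ⟨x', hx'⟩ := hv
      obtain ⟨z, rfl⟩ := y.2.2 x' hx'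
      refine ⟨z, h.injV ?_, Subtype.ext hx'⟩
      rw [← H.interface, hx', hxy]
    · push Not at hv
      exact absurd y.2.1 (hxy ▸ H.node_right x fun y' => by rw [hxy]; exact hv y')
  · intro x y hxy
    exact absurd (congrArg Subtype.val hxy) (hright y.1 y.2 x)

theorem directDerives (H : Rewrites r g h) (hg : Dangling r.left g) [IsEmpty r.K.E] :
    r.DirectDerives N.graph N'.graph := by
  obtain ⟨D, d, i, j, h₁, h₂⟩ := H.exists_gluing hg
  exact ⟨D, g.hom, d, h.hom, i, j, h₁, h₂⟩

end Rewrites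

/-- A direct derivation from a graph described by a net comes from a match into the net; its result
is described by every net to which this match rewrites. -/
theorem exists_match {r : GRule A B} [IsEmpty r.K.E] {N : Net ν ε A B} {G H : LGraph A B}
    (hG : Iso G N.graph) (hGH : r.DirectDerives G H) :
    ∃ g : Match r.L N, Dangling r.left g ∧
      ∀ (N' : Net ν ε A B) (g' : Match r.L N) (h : Match r.R N'), g'.V = g.V → g'.E = g.E →
        Rewrites r g' h → Iso H N'.graph := by
  obtain ⟨D, g, d, h, i, j, h₁, h₂⟩ := hGH.congr_left hG
  have hdang : Dangling r.left (Match.ofHom g h₁.inj_g) := by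
    intro e he hne x hx
    refine h₁.dangling ⟨e, he⟩ (fun y hy => hne y (congrArg Subtype.val hy)) x
      (hx.imp (fun h => Subtype.ext h) fun h => Subtype.ext h)
  refine ⟨Match.ofHom g h₁.inj_g, hdang, fun N' g' h' hV hE hR => ?_⟩
  obtain rfl : g' = Match.ofHom g h₁.inj_g := by
    cases g'
    cases hV
    cases hE
    rfl
  obtain ⟨D', d', i', j', h₁', h₂'⟩ := hR.exists_gluing hdang
  exact GRule.iso_of_same_match h₁ h₂ h₁' h₂'

end Net

/-! ### Programs, their reductions, and the diamond property -/

namespace EFD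

open NodeLabel EdgeLabel

/-- What follows a program point: the point does not exist, or it is an exit, or it is followed by
a statement, or by a decision with a `t`-successor and an `f`-successor. -/
inductive Cmd
  | dead
  | exit
  | stmt (b : ℕ)
  | dec (b c : ℕ)

namespace Cmd

/-- The successor along the edges with a given label. -/
def next : Cmd → EdgeLabel → Option ℕ
  | stmt b, blank => some b
  | dec b _, t => some b
  | dec _ c, f => some c
  | _, _ => none

def map (σ : ℕ → ℕ) : Cmd → Cmd
  | dead => dead
  | exit => exit
  | stmt b => stmt (σ b)
  | dec b c => dec (σ b) (σ c)

def IsCmd : Cmd → Prop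
  | dead => False
  | exit => False
  | stmt _ => True
  | dec _ _ => True

theorem next_map (σ : ℕ → ℕ) (c : Cmd) (l : EdgeLabel) : (c.map σ).next l = (c.next l).map σ := by
  cases c <;> cases l <;> rfl

theorem next_dead (l : EdgeLabel) : dead.next l = none := by cases l <;> rfl

theorem next_stmt {b c : ℕ} {l : EdgeLabel} : (stmt b).next l = some c ↔ l = blank ∧ b = c := by
  cases l <;> simp [next]

theorem next_dec {b c d : ℕ} {l : EdgeLabel} :
    (dec b c).next l = some d ↔ l = t ∧ b = d ∨ l = f ∧ c = d := by
  cases l <;> simp [next]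

theorem next_blank {c : Cmd} {b : ℕ} : c.next blank = some b ↔ c = stmt b := by
  cases c <;> simp [next]

theorem map_dead (σ : ℕ → ℕ) : dead.map σ = dead := rfl

theorem map_map (σ τ : ℕ → ℕ) (c : Cmd) : (c.map σ).map τ = c.map fun x => τ (σ x) := by
  cases c <;> rfl

theorem map_congr {σ τ : ℕ → ℕ} {c : Cmd} (h : ∀ l x, c.next l = some x → σ x = τ x) :
    c.map σ = c.map τ := by
  cases c with
  | dead => rfl
  | exit => rfl
  | stmt b => exact congrArg stmt (h blank b rfl)
  | dec b c => exact congrArg₂ dec (h t b rfl) (h f c rfl)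

theorem map_eq_self {σ : ℕ → ℕ} {c : Cmd} (h : ∀ l x, c.next l = some x → σ x = x) :
    c.map σ = c := by
  refine (map_congr h).trans ?_
  cases c <;> rfl

theorem map_ne_dead {σ : ℕ → ℕ} {c : Cmd} : c.map σ ≠ dead ↔ c ≠ dead := by
  cases c <;> simp [map]

theorem map_eq_exit {σ : ℕ → ℕ} {c : Cmd} : c.map σ = exit ↔ c = exit := by
  cases c <;> simp [map]

end Cmd

open Cmd

/-- Programs: the points are those natural numbers that are not mapped to `dead`. -/
abbrev Prog := ℕ → Cmd

namespace Prog

/-- An exit can be reached from a point. -/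
inductive Halts (s : Prog) : ℕ → Prop
  | exit {a : ℕ} (h : s a = exit) : Halts s a
  | step {a b : ℕ} {l : EdgeLabel} (h : (s a).next l = some b) (hb : Halts s b) : Halts s a

/-- The invariant of all graphs in the language. Halting is the essential clause: it forbids the
self-loops and two-statement cycles on which matches stop being injective and bypasses stop
commuting. -/
structure Good (s : Prog) : Prop where
  finite : {a | s a ≠ dead}.Finite
  closed : ∀ a b l, (s a).next l = some b → s b ≠ dead
  halts : ∀ a, s a ≠ dead → Halts s a

/-- The edge from (the command at) `a` labelled `l` is the only one into the point `b`. -/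
def OnlyRef (s : Prog) (b a : ℕ) (l : EdgeLabel) : Prop :=
  (s a).next l = some b ∧ ∀ a' l', (s a').next l' = some b → a' = a ∧ l' = l

def redirect (b d x : ℕ) : ℕ := if x = b then d else x

theorem redirect_self (b d : ℕ) : redirect b d b = d := if_pos rfl

theorem redirect_ne {b x : ℕ} (d : ℕ) (h : x ≠ b) : redirect b d x = x := if_neg h

/-- Delete the point `b` and redirect the edges into it to `d`. -/
def bypass (s : Prog) (b d : ℕ) : Prog := fun x =>
  if x = b then dead else (s x).map (redirect b d)

theorem bypass_self (s : Prog) (b d : ℕ) : bypass s b d b = dead := if_pos rfl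

theorem bypass_ne (s : Prog) {b x : ℕ} (d : ℕ) (h : x ≠ b) :
    bypass s b d x = (s x).map (redirect b d) := if_neg h

/-- Replace the command at `a` by a statement with successor `c`. -/
def collapse (s : Prog) (a c : ℕ) : Prog := Function.update s a (stmt c)

theorem collapse_self (s : Prog) (a c : ℕ) : collapse s a c a = stmt c :=
  Function.update_self ..

theorem collapse_ne (s : Prog) {a x : ℕ} (c : ℕ) (h : x ≠ a) : collapse s a c x = s x :=
  Function.update_of_ne h ..

/-- Reductions of programs. -/
inductive Red (s : Prog) : Prog → Prop
  | bypass {b d a : ℕ} {l : EdgeLabel} (hb : s b = stmt d) (h : OnlyRef s b a l) :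
      Red s (bypass s b d)
  | collapse {a z c : ℕ} (ha : s a = dec z c) (hz : z = a ∨ z = c) : Red s (collapse s a c)

variable {s : Prog}

/-- Every step from such a point returns to it, so a shortest path to an exit cannot start there;
formally, induction along the path. -/
theorem Halts.ne_dec_self {a : ℕ} (h : Halts s a) : s a ≠ dec a a := by
  induction h with
  | exit h => simp [h]
  | step h _ ih =>
    intro h'
    rw [h', next_dec] at h
    obtain ⟨-, rfl⟩ | ⟨-, rfl⟩ := h <;> exact ih h'

/-- One step along the cycle gives the same situation with `a` and `b` exchanged, so the induction
has to be uniform in `b`. -/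
theorem Halts.not_stmt_cycle {a : ℕ} (h : Halts s a) {b : ℕ} (hab : s a = stmt b) :
    s b ≠ stmt a := by
  induction h generalizing b with
  | exit h => simp [h] at hab
  | step h _ ih =>
    intro hba
    rw [hab, next_stmt] at h
    obtain ⟨-, rfl⟩ := h
    exact ih hba hab

theorem Good.ne_of_dec (hs : Good s) {a z c : ℕ} (ha : s a = dec z c) (hz : z = a ∨ z = c) :
    a ≠ c := by
  rintro rfl
  obtain rfl : z = a := by tauto
  exact (hs.halts z (by simp [ha])).ne_dec_self ha

theorem Good.not_stmt_cycle (hs : Good s) {a b : ℕ} (hab : s a = stmt b) : s b ≠ stmt a :=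
  (hs.halts a (by simp [hab])).not_stmt_cycle hab

theorem Good.ne_of_stmt (hs : Good s) {a b : ℕ} (hab : s a = stmt b) : a ≠ b := by
  rintro rfl
  exact hs.not_stmt_cycle hab hab

theorem next_bypass_of_ne {b d x y : ℕ} {l : EdgeLabel} (hy : (s x).next l = some y) (hx : x ≠ b) :
    (bypass s b d x).next l = some (redirect b d y) := by
  rw [bypass_ne s d hx, next_map, hy, Option.map_some]

theorem next_bypass {b d x y : ℕ} {l : EdgeLabel} (h : (bypass s b d x).next l = some y) :
    x ≠ b ∧ ∃ y', (s x).next l = some y' ∧ redirect b d y' = y := by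
  by_cases hx : x = b
  · rw [hx, bypass_self, next_dead] at h
    cases h
  · rw [bypass_ne s d hx, next_map, Option.map_eq_some_iff] at h
    exact ⟨hx, h⟩

/-- A path to an exit survives when its visits to `b` are contracted to the successor `d`; goodness
supplies `d ≠ b`. -/
theorem Good.bypass (hs : Good s) {b d : ℕ} (hb : s b = stmt d) : Good (bypass s b d) := by
  have hbd := hs.ne_of_stmt hb
  have hdead : ∀ x, Prog.bypass s b d x ≠ dead ↔ x ≠ b ∧ s x ≠ dead := by
    intro x
    by_cases hx : x = b
    · simp [hx, bypass_self]
    · simp [bypass_ne s d hx, map_ne_dead, hx]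
  have hhalts : ∀ x, Halts s x → Halts (Prog.bypass s b d) (redirect b d x) := by
    intro x hx
    induction hx with
    | @exit a h =>
      have hab : a ≠ b := by rintro rfl; simp [hb] at h
      rw [redirect_ne d hab]
      exact .exit (by rw [bypass_ne s d hab, h]; rfl)
    | @step a a' l h _ ih =>
      -- At `b` the step to `d` is contracted: `redirect` sends `b` to `d`, where the path already
      -- constructed starts.
      by_cases hab : a = b
      · subst hab
        rw [hb, next_stmt] at h
        obtain ⟨-, rfl⟩ := h
        rw [redirect_ne d hbd.symm] at ih
        rwa [redirect_self]
      · rw [redirect_ne d hab]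
        exact .step (next_bypass_of_ne h hab) ih
  refine ⟨hs.finite.subset fun x hx => ((hdead x).1 hx).2, fun x y l h => ?_, fun x hx => ?_⟩
  · obtain ⟨hx, y', hy', rfl⟩ := next_bypass h
    rw [hdead]
    by_cases hy : y' = b
    · rw [hy, redirect_self]
      exact ⟨hbd.symm, hs.closed b d blank (by rw [hb]; rfl)⟩
    · rw [redirect_ne d hy]
      exact ⟨hy, hs.closed _ _ _ hy'⟩
  · obtain ⟨hxb, hx⟩ := (hdead x).1 hx
    rw [← redirect_ne d hxb]
    exact hhalts x (hs.halts x hx)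

/-- Goodness is reflected by bypasses. -/
theorem Good.of_bypass {b d a : ℕ} {l : EdgeLabel} (hs : Good (Prog.bypass s b d))
    (hb : s b = stmt d) (hab : a ≠ b) (ha : (s a).next l = some b) : Good s := by
  have hd : Prog.bypass s b d d ≠ dead := by
    have := hs.closed _ _ _ (next_bypass_of_ne (d := d) ha hab)
    rwa [redirect_self] at this
  have hdb : d ≠ b := by
    rintro rfl
    exact hd (bypass_self _ _ _)
  have hdead : ∀ x, Prog.bypass s b d x ≠ dead → s x ≠ dead := by
    intro x hx
    by_cases hxb : x = b
    · simp [hxb, hb]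
    · rwa [bypass_ne s d hxb, map_ne_dead] at hx
  have hdead' : ∀ x, x ≠ b → s x ≠ dead → Prog.bypass s b d x ≠ dead := by
    intro x hxb hx
    rwa [bypass_ne s d hxb, map_ne_dead]
  have hhalts : ∀ x, Halts (Prog.bypass s b d) x → Halts s x := by
    intro x hx
    induction hx with
    | @exit x h =>
      have hxb : x ≠ b := by rintro rfl; simp [bypass_self] at h
      rw [bypass_ne s d hxb, map_eq_exit] at h
      exact .exit h
    | @step x y l h _ ih =>
      obtain ⟨-, y', hy', rfl⟩ := next_bypass h
      by_cases hy : y' = b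
      · rw [hy, redirect_self] at ih
        exact .step hy' (hy ▸ .step (l := blank) (by rw [hb]; rfl) ih)
      · rw [redirect_ne d hy] at ih
        exact .step hy' ih
  refine ⟨?_, fun x y l h => ?_, fun x hx => ?_⟩
  · refine (hs.finite.union (Set.finite_singleton b)).subset fun x hx => ?_
    by_cases hxb : x = b
    · exact Or.inr hxb
    · exact Or.inl (hdead' x hxb hx)
  · by_cases hy : y = b
    · simp [hy, hb]
    · by_cases hx : x = b
      · rw [hx, hb, next_stmt] at h
        obtain ⟨-, rfl⟩ := h
        exact hdead _ hd
      · have := hs.closed _ _ _ (next_bypass_of_ne (d := d) h hx)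
        rw [redirect_ne d hy] at this
        exact hdead _ this
  · by_cases hxb : x = b
    · rw [hxb]
      exact .step (l := blank) (by rw [hb]; rfl) (hhalts d (hs.halts d hd))
    · exact hhalts x (hs.halts x (hdead' x hxb hx))

theorem Good.collapse (hs : Good s) {a z c : ℕ} (ha : s a = dec z c) (hz : z = a ∨ z = c) :
    Good (Prog.collapse s a c) := by
  have hdead : ∀ x, Prog.collapse s a c x ≠ dead ↔ s x ≠ dead := by
    intro x
    by_cases hx : x = a
    · simp [hx, collapse_self, ha]
    · simp [collapse_ne s c hx]
  refine ⟨hs.finite.subset fun x hx => (hdead x).1 hx, fun x y l h => ?_, fun x hx => ?_⟩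
  · rw [hdead]
    by_cases hx : x = a
    · rw [hx, collapse_self, next_stmt] at h
      exact hs.closed a y f (by rw [ha, ← h.2]; rfl)
    · rw [collapse_ne s c hx] at h
      exact hs.closed _ _ _ h
  · have := hs.halts x ((hdead x).1 hx)
    clear hx
    induction this with
    | @exit x h =>
      have hxa : x ≠ a := by rintro rfl; simp [ha] at h
      exact .exit (by rw [collapse_ne s c hxa, h])
    | @step x y l h _ ih =>
      by_cases hx : x = a
      · subst hx
        rw [ha, next_dec] at h
        have hc : (Prog.collapse s x c x).next blank = some c := by rw [collapse_self]; rfl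
        rcases h with ⟨-, rfl⟩ | ⟨-, rfl⟩
        -- For a loop, the `t`-step stays at the same point, so it is dropped from the path.
        · rcases hz with rfl | rfl
          · exact ih
          · exact .step hc ih
        · exact .step hc ih
      · exact .step (by rw [collapse_ne s c hx, h]) ih

/-- Goodness is reflected by collapses. -/
theorem Good.of_collapse {a z c : ℕ} (hs : Good (Prog.collapse s a c)) (ha : s a = dec z c)
    (hz : z = a ∨ z = c) : Good s := by
  have hdead : ∀ x, Prog.collapse s a c x ≠ dead ↔ s x ≠ dead := by
    intro x
    by_cases hx : x = a
    · simp [hx, collapse_self, ha]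
    · simp [collapse_ne s c hx]
  have hc : s c ≠ dead := (hdead c).1 (hs.closed a c blank (by rw [collapse_self]; rfl))
  refine ⟨hs.finite.subset fun x hx => (hdead x).2 hx, fun x y l h => ?_, fun x hx => ?_⟩
  · by_cases hx : x = a
    · rw [hx, ha, next_dec] at h
      rcases h with ⟨-, rfl⟩ | ⟨-, rfl⟩
      · rcases hz with rfl | rfl
        · simp [ha]
        · exact hc
      · exact hc
    · exact (hdead y).1 (hs.closed x y l (by rw [collapse_ne s c hx, h]))
  · have := hs.halts x ((hdead x).2 hx)
    clear hx
    induction this with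
    | @exit x h =>
      have hxa : x ≠ a := by rintro rfl; simp [collapse_self] at h
      exact .exit (by rw [← h, collapse_ne s c hxa])
    | @step x y l h _ ih =>
      by_cases hx : x = a
      · subst hx
        rw [collapse_self, next_stmt] at h
        obtain ⟨-, rfl⟩ := h
        exact .step (l := f) (by rw [ha]; rfl) ih
      · rw [collapse_ne s c hx] at h
        exact .step h ih

theorem Good.red (hs : Good s) {s' : Prog} (h : Red s s') : Good s' := by
  cases h with
  | bypass hb _ => exact hs.bypass hb
  | collapse ha hz => exact hs.collapse ha hz

/-- Bypassing `b` preserves the number of references to another point. -/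
theorem OnlyRef.bypass (hs : Good s) {b d a b' a' : ℕ} {l l' : EdgeLabel} (hb : s b = stmt d)
    (h : OnlyRef s b a l) (h' : OnlyRef s b' a' l') (hne : b ≠ b') :
    ∃ a'' l'', OnlyRef (Prog.bypass s b d) b' a'' l'' := by
  have hab : a ≠ b := by
    rintro rfl
    have h1 := h.1
    rw [hb, next_stmt] at h1
    exact hs.ne_of_stmt hb h1.2.symm
  -- If `b` itself was the sole referrer of `b'`, this role passes to `a`.
  by_cases hd : d = b'
  · subst hd
    refine ⟨a, l, ?_, fun x m hx => ?_⟩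
    · rw [next_bypass_of_ne h.1 hab, redirect_self]
    · obtain ⟨hxb, y, hy, hyd⟩ := next_bypass hx
      by_cases hyb : y = b
      · exact h.2 _ _ (hyb ▸ hy)
      · rw [redirect_ne d hyb] at hyd
        subst hyd
        have h1 := h'.2 _ _ hy
        have h2 := h'.2 b blank (by rw [hb]; rfl)
        exact absurd (h1.1.trans h2.1.symm) hxb
  · have ha' : a' ≠ b := by
      rintro rfl
      have h1 := h'.1
      rw [hb, next_stmt] at h1
      exact hd h1.2
    refine ⟨a', l', ?_, fun x m hx => ?_⟩
    · rw [next_bypass_of_ne h'.1 ha', redirect_ne d hne.symm]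
    · obtain ⟨hxb, y, hy, hyd⟩ := next_bypass hx
      by_cases hyb : y = b
      · rw [hyb, redirect_self] at hyd
        exact absurd hyd hd
      · rw [redirect_ne d hyb] at hyd
        exact h'.2 _ _ (hyd ▸ hy)

/-- Either order contracts `b` and `b'` along the statement chain; the redirected targets cover the
case that one is the successor of the other. Only if each were the successor of the other would the
orders disagree, each keeping a different point, and goodness excludes this. -/
theorem bypass_comm (hs : Good s) {b d b' d' : ℕ} (hb : s b = stmt d) (hb' : s b' = stmt d')
    (hne : b ≠ b') :
    Prog.bypass (Prog.bypass s b d) b' (redirect b d d') =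
      Prog.bypass (Prog.bypass s b' d') b (redirect b' d' d) := by
  have hcycle : ¬ (d = b' ∧ d' = b) := by
    rintro ⟨rfl, rfl⟩
    exact hs.not_stmt_cycle hb hb'
  have h1 := hs.ne_of_stmt hb
  have h2 := hs.ne_of_stmt hb'
  funext x
  unfold Prog.bypass
  by_cases hx : x = b <;> by_cases hx' : x = b' <;> simp only [hx, hx', if_true, if_false, hne,
    hne.symm, map_dead, Cmd.map_map]
  refine Cmd.map_congr fun l y _ => ?_
  unfold redirect
  grind

theorem Red.bypass_bypass (hs : Good s) {b d a b' d' a' : ℕ} {l l' : EdgeLabel} (hb : s b = stmt d)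
    (h : OnlyRef s b a l) (hb' : s b' = stmt d') (h' : OnlyRef s b' a' l') (hne : b ≠ b') :
    Red (Prog.bypass s b d) (Prog.bypass (Prog.bypass s b d) b' (redirect b d d')) := by
  obtain ⟨a'', l'', h''⟩ := h.bypass hs hb h' hne
  exact .bypass (by rw [bypass_ne s d hne.symm, hb']; rfl) h''

/-- A bypass and a collapse commute. -/
theorem Red.bypass_collapse {b d a a' z c : ℕ} {l : EdgeLabel} (hb : s b = stmt d)
    (h : OnlyRef s b a l) (ha' : s a' = dec z c) (hz : z = a' ∨ z = c) :
    ∃ s₃, Red (Prog.bypass s b d) s₃ ∧ Red (Prog.collapse s a' c) s₃ := by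
  have hne : a' ≠ b := by
    rintro rfl
    simp [ha'] at hb
  -- In the case `z = c`, equality would make both branches of the decision refer to `b`, against
  -- uniqueness of its reference.
  have hzb : z ≠ b := by
    rcases hz with rfl | rfl
    · exact hne
    · rintro rfl
      have h1 := h.2 a' t (by rw [ha']; rfl)
      have h2 := h.2 a' f (by rw [ha']; rfl)
      cases h1.2.trans h2.2.symm
  refine ⟨Prog.collapse (Prog.bypass s b d) a' (redirect b d c), .collapse (z := z) ?_ ?_, ?_⟩
  · rw [bypass_ne s d hne, ha', Cmd.map, redirect_ne d hzb]
  · rcases hz with rfl | rfl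
    · exact Or.inl rfl
    · rw [redirect_ne d hzb]
      exact Or.inr rfl
  · have heq : Prog.collapse (Prog.bypass s b d) a' (redirect b d c) =
        Prog.bypass (Prog.collapse s a' c) b d := by
      funext x
      by_cases hxa : x = a'
      · rw [hxa, collapse_self, bypass_ne _ _ hne, collapse_self]
        rfl
      · rw [collapse_ne _ _ hxa]
        by_cases hxb : x = b
        · rw [hxb, bypass_self, bypass_self]
        · rw [bypass_ne _ _ hxb, bypass_ne _ _ hxb, collapse_ne _ _ hxa]
    rw [heq]
    have hb' : Prog.collapse s a' c b = stmt d := by rw [collapse_ne _ _ hne.symm, hb]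
    -- If the only reference to `b` is the `f`-edge of the decision, the collapse turns it into a
    -- blank edge. The bypass is still possible, but it now undoes `seq` instead of `dec2`.
    by_cases hc : c = b
    · subst hc
      refine .bypass (a := a') (l := blank) hb' ⟨by rw [collapse_self]; rfl, fun x m hx => ?_⟩
      by_cases hxa : x = a'
      · rw [hxa, collapse_self, next_stmt] at hx
        exact ⟨hxa, hx.1⟩
      · rw [collapse_ne _ _ hxa] at hx
        have h1 := h.2 x m hx
        have h2 := h.2 a' f (by rw [ha']; rfl)
        exact absurd (h1.1.trans h2.1.symm) hxa
    · have haa : a ≠ a' := by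
        rintro rfl
        have h1 := h.1
        rw [ha', next_dec] at h1
        tauto
      refine .bypass (a := a) (l := l) hb' ⟨by rw [collapse_ne _ _ haa]; exact h.1, fun x m hx => ?_⟩
      by_cases hxa : x = a'
      · rw [hxa, collapse_self, next_stmt] at hx
        exact absurd hx.2 hc
      · rw [collapse_ne _ _ hxa] at hx
        exact h.2 x m hx

/-- Two different reductions of a good program can be joined by one further step each. -/
theorem Red.diamond (hs : Good s) {s₁ s₂ : Prog} (h₁ : Red s s₁) (h₂ : Red s s₂) :
    s₁ = s₂ ∨ ∃ s₃, Red s₁ s₃ ∧ Red s₂ s₃ := by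
  cases h₁ with
  | @bypass b d a l hb h =>
    cases h₂ with
    | @bypass b' d' a' l' hb' h' =>
      by_cases hne : b = b'
      · subst hne
        rw [hb] at hb'
        cases hb'
        exact Or.inl rfl
      · refine Or.inr ⟨_, .bypass_bypass hs hb h hb' h' hne, ?_⟩
        rw [bypass_comm hs hb hb' hne]
        exact .bypass_bypass hs hb' h' hb h (Ne.symm hne)
    | @collapse a' z c ha' hz => exact Or.inr (Red.bypass_collapse hb h ha' hz)
  | @collapse a z c ha hz =>
    cases h₂ with
    | @bypass b d a' l hb h =>
      obtain ⟨s₃, h₁, h₂⟩ := Red.bypass_collapse hb h ha hz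
      exact Or.inr ⟨s₃, h₂, h₁⟩
    | @collapse a' z' c' ha' hz' =>
      by_cases hne : a = a'
      · subst hne
        rw [ha] at ha'
        cases ha'
        exact Or.inl rfl
      · refine Or.inr ⟨Prog.collapse (Prog.collapse s a c) a' c', ?_, ?_⟩
        · exact .collapse (by rw [collapse_ne _ _ (Ne.symm hne), ha']) hz'
        · rw [show Prog.collapse (Prog.collapse s a c) a' c' =
            Prog.collapse (Prog.collapse s a' c') a c from (Function.update_comm hne ..)]
          exact .collapse (by rw [collapse_ne _ _ hne, ha]) hz

/-- Reduction is confluent on good programs. -/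
theorem Red.confluent {s₁ s₂ : Prog} (hs : Good s) (h₁ : Relation.ReflTransGen Red s s₁)
    (h₂ : Relation.ReflTransGen Red s s₂) :
    ∃ s₃, Relation.ReflTransGen Red s₁ s₃ ∧ Relation.ReflTransGen Red s₂ s₃ := by
  -- Church–Rosser wants the local condition at every element, whereas the diamond holds at good
  -- programs only; so goodness is built into the relation.
  let R : Prog → Prog → Prop := fun a b => Good a ∧ Red a b
  have lift : ∀ {x : Prog}, Relation.ReflTransGen Red s x →
      Relation.ReflTransGen R s x ∧ Good x := by
    intro x hx
    induction hx with
    | refl => exact ⟨.refl, hs⟩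
    | tail _ h ih => exact ⟨ih.1.tail ⟨ih.2, h⟩, ih.2.red h⟩
  obtain ⟨s₃, h₁₃, h₂₃⟩ := Relation.church_rosser (r := R) (fun a b c hab hac => by
    rcases hab.2.diamond hab.1 hac.2 with rfl | ⟨d, hbd, hcd⟩
    · exact ⟨b, .refl, .refl⟩
    · exact ⟨d, .single ⟨hab.1.red hab.2, hbd⟩, .single ⟨hab.1.red hac.2, hcd⟩⟩)
    (lift h₁).1 (lift h₂).1
  exact ⟨s₃, Relation.ReflTransGen.mono (fun _ _ h => h.2) _ _ h₁₃,
    Relation.ReflTransGen.mono (fun _ _ h => h.2) _ _ h₂₃⟩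

end Prog

end EFD

/-! ### The graph of a program -/

namespace EFD

open NodeLabel EdgeLabel Cmd Prog

/-- The nodes of the graph of a program: its points and their commands. -/
inductive Name
  | pt (a : ℕ)
  | cmd (a : ℕ)

/-- The edges of the graph of a program: those into a command and those out of it. -/
inductive Arrow
  | into (a : ℕ)
  | out (a : ℕ) (l : EdgeLabel)

open Name Arrow

def Name.Mem (s : Prog) : Name → Prop
  | pt a => s a ≠ dead
  | cmd a => (s a).IsCmd

def Arrow.Mem (s : Prog) : Arrow → Prop
  | into a => (s a).IsCmd
  | out a l => ((s a).next l).isSome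

def Cmd.label : Cmd → NodeLabel
  | .dec _ _ => decision
  | _ => NodeLabel.stmt

def Name.label (s : Prog) : Name → NodeLabel
  | pt _ => point
  | cmd a => (s a).label

def Arrow.label : Arrow → EdgeLabel
  | into _ => blank
  | out _ l => l

def Arrow.src : Arrow → Name
  | into a => pt a
  | out a _ => cmd a

/-- The default `0` is never the target of an actual edge, because `out a l` is an edge only if the
successor exists. -/
def Arrow.tgt (s : Prog) : Arrow → Name
  | into a => cmd a
  | out a l => pt (((s a).next l).getD 0)

theorem Cmd.IsCmd.ne_dead {c : Cmd} (h : c.IsCmd) : c ≠ dead := by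
  rintro rfl
  exact h

theorem Cmd.isCmd_of_next {c : Cmd} {l : EdgeLabel} (h : (c.next l).isSome) : c.IsCmd := by
  cases c <;> cases l <;> simp_all [next, IsCmd]

theorem Cmd.isCmd_map {σ : ℕ → ℕ} {c : Cmd} : (c.map σ).IsCmd ↔ c.IsCmd := by
  cases c <;> rfl

theorem Cmd.label_map {σ : ℕ → ℕ} {c : Cmd} : (c.map σ).label = c.label := by
  cases c <;> rfl

@[simp] theorem Cmd.isCmd_stmt (b : ℕ) : (Cmd.stmt b).IsCmd := trivial

@[simp] theorem Cmd.isCmd_dec (b c : ℕ) : (dec b c).IsCmd := trivial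

@[simp] theorem Cmd.next_stmt_blank (b : ℕ) : (Cmd.stmt b).next blank = some b := rfl

@[simp] theorem Cmd.next_dec_t (b c : ℕ) : (dec b c).next t = some b := rfl

@[simp] theorem Cmd.next_dec_f (b c : ℕ) : (dec b c).next f = some c := rfl

@[simp] theorem Cmd.label_stmt (b : ℕ) : (Cmd.stmt b).label = NodeLabel.stmt := rfl

@[simp] theorem Cmd.label_dec (b c : ℕ) : (dec b c).label = decision := rfl

/-- The graph of a program. -/
def enc (s : Prog) (hs : Good s) : Net Name Arrow NodeLabel EdgeLabel where
  nodes := {x | x.Mem s}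
  edges := {e | e.Mem s}
  src := Arrow.src
  tgt := Arrow.tgt s
  nodeLabel := Name.label s
  edgeLabel := Arrow.label
  finite_nodes := by
    refine ((hs.finite.image pt).union (hs.finite.image cmd)).subset ?_
    rintro (a | a) h
    · exact Or.inl ⟨a, h, rfl⟩
    · exact Or.inr ⟨a, IsCmd.ne_dead h, rfl⟩
  finite_edges := by
    refine ((hs.finite.image into).union ((hs.finite.image (out · t)).union
      ((hs.finite.image (out · f)).union (hs.finite.image (out · blank))))).subset ?_
    rintro (a | ⟨a, l⟩) h
    · exact Or.inl ⟨a, IsCmd.ne_dead h, rfl⟩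
    · have ha : s a ≠ dead := IsCmd.ne_dead (isCmd_of_next h)
      cases l
      · exact Or.inr (Or.inl ⟨a, ha, rfl⟩)
      · exact Or.inr (Or.inr (Or.inl ⟨a, ha, rfl⟩))
      · exact Or.inr (Or.inr (Or.inr ⟨a, ha, rfl⟩))
  src_mem := by
    rintro (a | ⟨a, l⟩) h
    · exact IsCmd.ne_dead h
    · exact isCmd_of_next h
  tgt_mem := by
    rintro (a | ⟨a, l⟩) h
    · exact h
    · obtain ⟨b, hb⟩ := Option.isSome_iff_exists.1 h
      change s (((s a).next l).getD 0) ≠ dead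
      rw [hb]
      exact hs.closed a b l hb

/-- A match of an explicitly given graph. -/
def _root_.Net.Match.ofFin {ν ε : Type} {N : Net ν ε NodeLabel EdgeLabel} {n m : ℕ}
    {lab : Fin n → NodeLabel} {edge : Fin m → Fin n × EdgeLabel × Fin n} (V : Fin n → ν)
    (E : Fin m → ε) (hV : ∀ x, V x ∈ N.nodes ∧ N.nodeLabel (V x) = lab x)
    (hE : ∀ e, E e ∈ N.edges ∧ N.src (E e) = V (edge e).1 ∧ N.edgeLabel (E e) = (edge e).2.1 ∧
      N.tgt (E e) = V (edge e).2.2)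
    (injV : Function.Injective V) (injE : Function.Injective E) :
    Net.Match (graph lab edge) N where
  V := V
  E := E
  memV x := (hV x).1
  memE e := (hE e).1
  src e := (hE e).2.1
  tgt e := (hE e).2.2.2
  edgeLabel e := (hE e).2.2.1
  nodeLabel x := (hV x).2
  injV := injV
  injE := injE

variable {s : Prog}

@[simp] theorem pt_mem_enc {hs : Good s} {a : ℕ} : pt a ∈ (enc s hs).nodes ↔ s a ≠ dead := Iff.rfl

@[simp] theorem cmd_mem_enc {hs : Good s} {a : ℕ} : cmd a ∈ (enc s hs).nodes ↔ (s a).IsCmd :=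
  Iff.rfl

@[simp] theorem into_mem_enc {hs : Good s} {a : ℕ} : into a ∈ (enc s hs).edges ↔ (s a).IsCmd :=
  Iff.rfl

@[simp] theorem out_mem_enc {hs : Good s} {a : ℕ} {l : EdgeLabel} :
    out a l ∈ (enc s hs).edges ↔ ((s a).next l).isSome := Iff.rfl

@[simp] theorem enc_nodeLabel_pt {hs : Good s} {a : ℕ} : (enc s hs).nodeLabel (pt a) = point := rfl

@[simp] theorem enc_nodeLabel_cmd {hs : Good s} {a : ℕ} :
    (enc s hs).nodeLabel (cmd a) = (s a).label := rfl

@[simp] theorem enc_src_into {hs : Good s} {a : ℕ} : (enc s hs).src (into a) = pt a := rfl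

@[simp] theorem enc_src_out {hs : Good s} {a : ℕ} {l : EdgeLabel} :
    (enc s hs).src (out a l) = cmd a := rfl

@[simp] theorem enc_tgt_into {hs : Good s} {a : ℕ} : (enc s hs).tgt (into a) = cmd a := rfl

@[simp] theorem enc_tgt_out {hs : Good s} {a : ℕ} {l : EdgeLabel} :
    (enc s hs).tgt (out a l) = pt (((s a).next l).getD 0) := rfl

@[simp] theorem enc_edgeLabel_into {hs : Good s} {a : ℕ} : (enc s hs).edgeLabel (into a) = blank :=
  rfl

@[simp] theorem enc_edgeLabel_out {hs : Good s} {a : ℕ} {l : EdgeLabel} :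
    (enc s hs).edgeLabel (out a l) = l := rfl

theorem Arrow.tgt_out {a b : ℕ} {l : EdgeLabel} (h : (s a).next l = some b) :
    (out a l).tgt s = pt b := by
  simp [Arrow.tgt, h]

theorem Name.mem_bypass {b d : ℕ} {x : Name} (h : x ≠ pt b) (h' : x ≠ cmd b) :
    (x.Mem (bypass s b d) ↔ x.Mem s) ∧ x.label (bypass s b d) = x.label s := by
  cases x with
  | pt x =>
    have hx : x ≠ b := fun hx => h (hx ▸ rfl)
    simp [Name.Mem, Name.label, bypass_ne s d hx, map_ne_dead]
  | cmd x =>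
    have hx : x ≠ b := fun hx => h' (hx ▸ rfl)
    simp [Name.Mem, Name.label, bypass_ne s d hx, isCmd_map, label_map]

/-- The three excluded arrows are the two that vanish with `b` and the single one whose target is
redirected; uniqueness of the reference guarantees that there are no more. -/
theorem Arrow.mem_bypass {b d a : ℕ} {l : EdgeLabel} (hb : s b = stmt d) (h : OnlyRef s b a l)
    {e : Arrow} (h₁ : e ≠ into b) (h₂ : e ≠ out b blank) (h₃ : e ≠ out a l) :
    (e.Mem (bypass s b d) ↔ e.Mem s) ∧ (e.Mem s → e.tgt (bypass s b d) = e.tgt s) := by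
  cases e with
  | into x =>
    have hx : x ≠ b := fun hx => h₁ (hx ▸ rfl)
    simp [Arrow.Mem, Arrow.tgt, bypass_ne s d hx, isCmd_map]
  | out x m =>
    by_cases hx : x = b
    · subst hx
      have hm : m ≠ blank := fun hm => h₂ (hm ▸ rfl)
      have : (s x).next m = none := by
        rw [hb]
        cases m <;> simp_all [next]
      simp [Arrow.Mem, bypass_self, next_dead, this]
    · refine ⟨by simp [Arrow.Mem, bypass_ne s d hx, next_map], fun hm => ?_⟩
      obtain ⟨y, hy⟩ := Option.isSome_iff_exists.1 hm
      have hyb : y ≠ b := by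
        rintro rfl
        obtain ⟨rfl, rfl⟩ := h.2 _ _ hy
        exact h₃ rfl
      rw [Arrow.tgt_out hy, Arrow.tgt_out (next_bypass_of_ne hy hx), redirect_ne d hyb]

theorem Name.mem_collapse {a c : ℕ} {x : Name} (h : x ≠ pt a) (h' : x ≠ cmd a) :
    (x.Mem (collapse s a c) ↔ x.Mem s) ∧ x.label (collapse s a c) = x.label s := by
  cases x with
  | pt x =>
    have hx : x ≠ a := fun hx => h (hx ▸ rfl)
    simp [Name.Mem, Name.label, collapse_ne s c hx]
  | cmd x =>
    have hx : x ≠ a := fun hx => h' (hx ▸ rfl)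
    simp [Name.Mem, Name.label, collapse_ne s c hx]

theorem Arrow.mem_collapse {z c a : ℕ} (ha : s a = dec z c) {e : Arrow} (h₁ : e ≠ into a)
    (h₂ : e ≠ out a t) (h₃ : e ≠ out a f) (h₄ : e ≠ out a blank) :
    (e.Mem (collapse s a c) ↔ e.Mem s) ∧ e.tgt (collapse s a c) = e.tgt s := by
  cases e with
  | into x =>
    have hx : x ≠ a := fun hx => h₁ (hx ▸ rfl)
    simp [Arrow.Mem, Arrow.tgt, collapse_ne s c hx]
  | out x m =>
    have hx : x ≠ a := by
      rintro rfl
      cases m <;> tauto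
    simp [Arrow.Mem, Arrow.tgt, collapse_ne s c hx]

/-! ### Shapes of the sides of the rules -/

/-- `• → □ → •` -/
abbrev stmtGraph : LGraph NodeLabel EdgeLabel :=
  graph (n := 3) (m := 2) ![point, NodeLabel.stmt, point] ![(0, blank, 1), (1, blank, 2)]

/-- `• → □ → • → □ → •` -/
abbrev seqGraph : LGraph NodeLabel EdgeLabel :=
  graph (n := 5) (m := 4) ![point, NodeLabel.stmt, point, point, NodeLabel.stmt]
    ![(0, blank, 1), (1, blank, 3), (3, blank, 4), (4, blank, 2)]

/-- The decision that is left by `whileLoop` (`z = 0`) or `ddec` (`z = 2`). -/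
abbrev decisionGraph (z : Fin 3) : LGraph NodeLabel EdgeLabel :=
  graph (n := 3) (m := 3) ![point, decision, point] ![(0, blank, 1), (1, t, z), (1, f, 2)]

/-- The edge that is expanded by `dec1` and `dec2`. -/
abbrev branchGraph (x : EdgeLabel) : LGraph NodeLabel EdgeLabel :=
  graph (n := 2) (m := 1) ![decision, point] ![(0, x, 1)]

/-- The result of expanding a branch. -/
abbrev longBranchGraph (x : EdgeLabel) : LGraph NodeLabel EdgeLabel :=
  graph (n := 4) (m := 3) ![decision, point, point, NodeLabel.stmt]
    ![(0, x, 2), (2, blank, 3), (3, blank, 1)]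

/-- `whileLoop` and `ddec`. -/
def decisionRule (z : Fin 3) : GRule NodeLabel EdgeLabel :=
  rule (n := 3) (m := 2) (n' := 3) (m' := 3) (k := 2)
    ![point, NodeLabel.stmt, point] ![(0, blank, 1), (1, blank, 2)]
    ![point, decision, point] ![(0, blank, 1), (1, t, z), (1, f, 2)]
    ![0, 2] ![0, 2] (by decide) (by decide) (by decide)

/-- `dec1` and `dec2`. -/
def branchRule (x : EdgeLabel) : GRule NodeLabel EdgeLabel :=
  rule (n := 2) (m := 1) (n' := 4) (m' := 3) (k := 2)
    ![decision, point] ![(0, x, 1)]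
    ![decision, point, point, NodeLabel.stmt] ![(0, x, 2), (2, blank, 3), (3, blank, 1)]
    ![0, 1] ![0, 1] (by decide) (by decide) (by decide)

section

variable (hs : Good s)

def matchStmt {a d : ℕ} (h : s a = stmt d) : Net.Match stmtGraph (enc s hs) :=
  .ofFin ![pt a, cmd a, pt d] ![into a, out a blank]
    (by
      have := hs.closed a d blank (by rw [h]; rfl)
      simp [Fin.forall_fin_succ, h, this])
    (by simp [Fin.forall_fin_succ, h])
    (by
      have := hs.ne_of_stmt h
      intro x y
      fin_cases x <;> fin_cases y <;> simp [this, this.symm])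
    (by
      intro x y
      fin_cases x <;> fin_cases y <;> simp)

def matchSeq {a b d : ℕ} (h : s a = stmt b) (hb : s b = stmt d) :
    Net.Match seqGraph (enc s hs) :=
  .ofFin ![pt a, cmd a, pt d, pt b, cmd b] ![into a, out a blank, into b, out b blank]
    (by
      have := hs.closed b d blank (by rw [hb]; rfl)
      simp [Fin.forall_fin_succ, h, hb, this])
    (by simp [Fin.forall_fin_succ, h, hb])
    (by
      have h₁ := hs.ne_of_stmt h
      have h₂ := hs.ne_of_stmt hb
      -- The ends of the sequence are distinct because there is no two-statement cycle; without this
      -- the match would not be injective.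
      have h₃ : a ≠ d := by
        rintro rfl
        exact hs.not_stmt_cycle h hb
      intro x y
      fin_cases x <;> fin_cases y <;> simp [h₁, h₁.symm, h₂, h₂.symm, h₃, h₃.symm])
    (by
      have h₁ := hs.ne_of_stmt h
      intro x y
      fin_cases x <;> fin_cases y <;> simp [h₁, h₁.symm])

/-- The index `i` is the node hit by the `t`-edge, which lets one definition serve `whileLoop` (`i =
0`) and `ddec` (`i = 2`). -/
def matchDecision (i : Fin 3) {a z c : ℕ} (h : s a = dec z c) (hne : a ≠ c)
    (hi : ![pt a, cmd a, pt c] i = pt z) : Net.Match (decisionGraph i) (enc s hs) :=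
  .ofFin ![pt a, cmd a, pt c] ![into a, out a t, out a f]
    (by
      have := hs.closed a c f (by rw [h]; rfl)
      simp [Fin.forall_fin_succ, h, this])
    (by simp [Fin.forall_fin_succ, h, hi])
    (by
      intro x y
      fin_cases x <;> fin_cases y <;> simp [hne, hne.symm])
    (by
      intro x y
      fin_cases x <;> fin_cases y <;> simp)

theorem Cmd.label_eq_decision {c : Cmd} {x : EdgeLabel} (hx : x ≠ blank) {b : ℕ}
    (h : c.next x = some b) : c.label = decision := by
  cases c <;> cases x <;> simp_all [next]

def matchBranch {x : EdgeLabel} (hx : x ≠ blank) {a d : ℕ} (h : (s a).next x = some d) :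
    Net.Match (branchGraph x) (enc s hs) :=
  .ofFin ![cmd a, pt d] ![out a x]
    (by
      have h₁ := hs.closed a d x h
      have h₂ : (s a).IsCmd := isCmd_of_next (by rw [h]; rfl)
      have h₃ := Cmd.label_eq_decision hx h
      simp [Fin.forall_fin_succ, h₁, h₂, h₃])
    (by simp [h])
    (by
      intro x y
      fin_cases x <;> fin_cases y <;> simp)
    (Function.injective_of_subsingleton _)

def matchLongBranch {x : EdgeLabel} (hx : x ≠ blank) {a b d : ℕ} (h : (s a).next x = some b)
    (hb : s b = stmt d) : Net.Match (longBranchGraph x) (enc s hs) :=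
  have hab : a ≠ b := by
    rintro rfl
    rw [hb, next_stmt] at h
    exact hx h.1
  .ofFin ![cmd a, pt d, pt b, cmd b] ![out a x, into b, out b blank]
    (by
      have h₁ := hs.closed b d blank (by rw [hb]; rfl)
      have h₂ : (s a).IsCmd := isCmd_of_next (by rw [h]; rfl)
      have h₃ := Cmd.label_eq_decision hx h
      simp [Fin.forall_fin_succ, h₁, h₂, h₃, hb])
    (by simp [Fin.forall_fin_succ, h, hb])
    (by
      have h₂ := hs.ne_of_stmt hb
      intro x y
      fin_cases x <;> fin_cases y <;> simp [h₂, h₂.symm, hab, hab.symm])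
    (by
      intro x y
      fin_cases x <;> fin_cases y <;> simp [hab, hab.symm])

end

/-! ### Bypass and collapse as rewriting of graphs -/

variable {s' : Prog}

instance : IsEmpty seq.K.E := Fin.isEmpty

instance (z : Fin 3) : IsEmpty (decisionRule z).K.E := Fin.isEmpty

instance (x : EdgeLabel) : IsEmpty (branchRule x).K.E := Fin.isEmpty

/-- The arrow `out a blank` occurs in both nets under one name but with different targets. This is
harmless: it lies in both matches, and only names outside them have to agree. -/
theorem rewrites_seq (hs : Good s) (hs' : Good s') {a b d : ℕ} (hs₁ : s' = bypass s b d)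
    (ha : s a = stmt b) (hb : s b = stmt d) (ha' : s' a = stmt d) (h : OnlyRef s b a blank) :
    Net.Rewrites seq (matchStmt hs' ha') (matchSeq hs ha hb) := by
  subst hs₁
  constructor
  · intro (z : Fin 3)
    fin_cases z <;> rfl
  · intro x _ hx
    have := Name.mem_bypass (s := s) (d := d) (Ne.symm (hx (3 : Fin 5))) (Ne.symm (hx (4 : Fin 5)))
    exact ⟨this.1, fun _ => this.2⟩
  · intro (y : Fin 3) hy
    fin_cases y
    · exact absurd rfl (hy (0 : Fin 5))
    · exact absurd rfl (hy (1 : Fin 5))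
    · exact absurd rfl (hy (2 : Fin 5))
  · intro (y : Fin 5) hy
    fin_cases y
    · exact absurd rfl (hy (0 : Fin 3))
    · exact absurd rfl (hy (1 : Fin 3))
    · exact absurd rfl (hy (2 : Fin 3))
    · exact fun h => h (bypass_self s b d)
    · intro h
      change (bypass s b d b).IsCmd at h
      rw [bypass_self] at h
      exact h
  · intro e _ he
    have := Arrow.mem_bypass (s := s) hb h (Ne.symm (he (2 : Fin 4))) (Ne.symm (he (3 : Fin 4)))
      (Ne.symm (he (1 : Fin 4)))
    exact ⟨this.1, fun he => ⟨rfl, this.2 (this.1.1 he), rfl⟩⟩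
  · intro (y : Fin 2) hy
    fin_cases y
    · exact absurd rfl (hy (0 : Fin 4))
    · exact absurd rfl (hy (1 : Fin 4))
  · intro (y : Fin 4) hy
    fin_cases y
    · exact absurd rfl (hy (0 : Fin 2))
    · exact absurd rfl (hy (1 : Fin 2))
    · intro h
      change (bypass s b d b).IsCmd at h
      rw [bypass_self] at h
      exact h
    · intro h
      change ((bypass s b d b).next blank).isSome at h
      rw [bypass_self] at h
      cases h

theorem rewrites_branch (hs : Good s) (hs' : Good s') {x : EdgeLabel} (hx : x ≠ blank) {a b d : ℕ}
    (hs₁ : s' = bypass s b d) (ha : (s a).next x = some b) (hb : s b = stmt d)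
    (ha' : (s' a).next x = some d) (h : OnlyRef s b a x) :
    Net.Rewrites (branchRule x) (matchBranch hs' hx ha') (matchLongBranch hs hx ha hb) := by
  subst hs₁
  constructor
  · intro (z : Fin 2)
    fin_cases z <;> rfl
  · intro x _ hx
    have := Name.mem_bypass (s := s) (d := d) (Ne.symm (hx (2 : Fin 4))) (Ne.symm (hx (3 : Fin 4)))
    exact ⟨this.1, fun _ => this.2⟩
  · intro (y : Fin 2) hy
    fin_cases y
    · exact absurd rfl (hy (0 : Fin 4))
    · exact absurd rfl (hy (1 : Fin 4))
  · intro (y : Fin 4) hy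
    fin_cases y
    · exact absurd rfl (hy (0 : Fin 2))
    · exact absurd rfl (hy (1 : Fin 2))
    · exact fun h => h (bypass_self s b d)
    · intro h
      change (bypass s b d b).IsCmd at h
      rw [bypass_self] at h
      exact h
  · intro e _ he
    have := Arrow.mem_bypass (s := s) hb h (Ne.symm (he (1 : Fin 3))) (Ne.symm (he (2 : Fin 3)))
      (Ne.symm (he (0 : Fin 3)))
    exact ⟨this.1, fun he => ⟨rfl, this.2 (this.1.1 he), rfl⟩⟩
  · intro (y : Fin 1) hy
    fin_cases y
    exact absurd rfl (hy (0 : Fin 3))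
  · intro (y : Fin 3) hy
    fin_cases y
    · exact absurd rfl (hy (0 : Fin 1))
    · intro h
      change (bypass s b d b).IsCmd at h
      rw [bypass_self] at h
      exact h
    · intro h
      change ((bypass s b d b).next blank).isSome at h
      rw [bypass_self] at h
      cases h

/-- The name `cmd a` is reused although its label changes. It is no interface node, so the rule
deletes it and creates it anew. -/
theorem rewrites_decision (hs : Good s) (hs' : Good s') (i : Fin 3) {a z c : ℕ}
    (hs₁ : s' = collapse s a c) (ha : s a = dec z c) (hne : a ≠ c)
    (hi : ![pt a, cmd a, pt c] i = pt z) (ha' : s' a = stmt c) :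
    Net.Rewrites (decisionRule i) (matchStmt hs' ha') (matchDecision hs i ha hne hi) := by
  subst hs₁
  constructor
  · intro (z : Fin 2)
    fin_cases z <;> rfl
  · intro x _ hx
    have := Name.mem_collapse (s := s) (c := c) (Ne.symm (hx (0 : Fin 3)))
      (Ne.symm (hx (1 : Fin 3)))
    exact ⟨this.1, fun _ => this.2⟩
  · intro (y : Fin 3) hy
    exact absurd rfl (hy y)
  · intro (y : Fin 3) hy
    exact absurd rfl (hy y)
  · intro e he' he
    have := Arrow.mem_collapse ha (Ne.symm (he (0 : Fin 3))) (Ne.symm (he (1 : Fin 3)))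
      (Ne.symm (he (2 : Fin 3))) (Ne.symm (he' (1 : Fin 2)))
    exact ⟨this.1, fun he => ⟨rfl, this.2, rfl⟩⟩
  · intro (y : Fin 2) hy
    fin_cases y
    · exact absurd rfl (hy (0 : Fin 3))
    · intro h
      change ((s a).next blank).isSome at h
      rw [ha] at h
      cases h
  · intro (y : Fin 3) hy
    fin_cases y
    · exact absurd rfl (hy (0 : Fin 2))
    · intro h
      change ((collapse s a c a).next t).isSome at h
      rw [collapse_self] at h
      cases h
    · intro h
      change ((collapse s a c a).next f).isSome at h
      rw [collapse_self] at h
      cases h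

/-! ### Matches into the graph of a program -/

theorem eq_into {hs : Good s} {e : Arrow} {a : ℕ} (h : (enc s hs).src e = pt a) : e = into a := by
  cases e <;> simp_all

/-- Determinism of program graphs: source and label determine an edge. This forces a whole match
from the image of its first node. -/
theorem eq_out {hs : Good s} {e : Arrow} {a : ℕ} {l : EdgeLabel} (h : (enc s hs).src e = cmd a)
    (hl : (enc s hs).edgeLabel e = l) : e = out a l := by
  cases e <;> simp_all

theorem eq_pt {hs : Good s} {x : Name} (h : (enc s hs).nodeLabel x = point) : ∃ a, x = pt a := by
  cases x with
  | pt a => exact ⟨a, rfl⟩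
  | cmd a => cases hsa : s a <;> simp [hsa, Cmd.label] at h

theorem eq_cmd {hs : Good s} {x : Name} (h : (enc s hs).nodeLabel x ≠ point) : ∃ a, x = cmd a := by
  cases x with
  | pt a => exact absurd rfl h
  | cmd a => exact ⟨a, rfl⟩

theorem out_mem {hs : Good s} {a : ℕ} {l : EdgeLabel} {x : Name} (h : out a l ∈ (enc s hs).edges)
    (hx : (enc s hs).tgt (out a l) = x) : ∃ b, x = pt b ∧ (s a).next l = some b := by
  obtain ⟨b, hb⟩ := Option.isSome_iff_exists.1 h
  exact ⟨b, hx.symm.trans (Arrow.tgt_out hb), hb⟩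

theorem exists_eq_matchStmt (hs : Good s) (g : Net.Match stmtGraph (enc s hs)) :
    ∃ (a d : ℕ) (h : s a = stmt d), (matchStmt hs h).V = g.V ∧ (matchStmt hs h).E = g.E := by
  obtain ⟨V, E, memV, memE, src, tgt, el, nl, -, -⟩ := g
  dsimp only at *
  change Fin 3 → Name at V
  change Fin 2 → Arrow at E
  obtain ⟨a, h0⟩ := eq_pt (nl (0 : Fin 3))
  have e0 : E 0 = into a := eq_into ((src (0 : Fin 2)).trans h0)
  have h1 : V 1 = cmd a := (tgt (0 : Fin 2)).symm.trans (by rw [e0]; rfl)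
  have e1 : E 1 = out a blank := eq_out ((src (1 : Fin 2)).trans h1) (el (1 : Fin 2))
  obtain ⟨d, h2, hd⟩ := out_mem (e1 ▸ memE (1 : Fin 2)) (e1 ▸ tgt (1 : Fin 2))
  refine ⟨a, d, next_blank.1 hd, ?_, ?_⟩
  · funext (x : Fin 3)
    fin_cases x
    exacts [h0.symm, h1.symm, h2.symm]
  · funext (x : Fin 2)
    fin_cases x
    exacts [e0.symm, e1.symm]

theorem exists_eq_matchSeq (hs : Good s) (g : Net.Match seqGraph (enc s hs)) :
    ∃ (a b d : ℕ) (h : s a = stmt b) (hb : s b = stmt d),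
      (matchSeq hs h hb).V = g.V ∧ (matchSeq hs h hb).E = g.E := by
  obtain ⟨V, E, memV, memE, src, tgt, el, nl, -, -⟩ := g
  dsimp only at *
  change Fin 5 → Name at V
  change Fin 4 → Arrow at E
  obtain ⟨a, h0⟩ := eq_pt (nl (0 : Fin 5))
  have e0 : E 0 = into a := eq_into ((src (0 : Fin 4)).trans h0)
  have h1 : V 1 = cmd a := (tgt (0 : Fin 4)).symm.trans (by rw [e0]; rfl)
  have e1 : E 1 = out a blank := eq_out ((src (1 : Fin 4)).trans h1) (el (1 : Fin 4))
  obtain ⟨b, h3, hb⟩ := out_mem (e1 ▸ memE (1 : Fin 4)) (e1 ▸ tgt (1 : Fin 4))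
  have e2 : E 2 = into b := eq_into ((src (2 : Fin 4)).trans h3)
  have h4 : V 4 = cmd b := (tgt (2 : Fin 4)).symm.trans (by rw [e2]; rfl)
  have e3 : E 3 = out b blank := eq_out ((src (3 : Fin 4)).trans h4) (el (3 : Fin 4))
  obtain ⟨d, h2, hd⟩ := out_mem (e3 ▸ memE (3 : Fin 4)) (e3 ▸ tgt (3 : Fin 4))
  refine ⟨a, b, d, next_blank.1 hb, next_blank.1 hd, ?_, ?_⟩
  · funext (x : Fin 5)
    fin_cases x
    exacts [h0.symm, h1.symm, h2.symm, h3.symm, h4.symm]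
  · funext (x : Fin 4)
    fin_cases x
    exacts [e0.symm, e1.symm, e2.symm, e3.symm]

theorem exists_eq_matchDecision (hs : Good s) (i : Fin 3)
    (g : Net.Match (decisionGraph i) (enc s hs)) :
    ∃ (a z c : ℕ) (h : s a = dec z c) (hne : a ≠ c) (hi : ![pt a, cmd a, pt c] i = pt z),
      (matchDecision hs i h hne hi).V = g.V ∧ (matchDecision hs i h hne hi).E = g.E := by
  obtain ⟨V, E, memV, memE, src, tgt, el, nl, injV, -⟩ := g
  dsimp only at *
  change Fin 3 → Name at V
  change Fin 3 → Arrow at E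
  obtain ⟨a, h0⟩ := eq_pt (nl (0 : Fin 3))
  have e0 : E 0 = into a := eq_into ((src (0 : Fin 3)).trans h0)
  have h1 : V 1 = cmd a := (tgt (0 : Fin 3)).symm.trans (by rw [e0]; rfl)
  have e1 : E 1 = out a t := eq_out ((src (1 : Fin 3)).trans h1) (el (1 : Fin 3))
  obtain ⟨z, hi, hz⟩ := out_mem (e1 ▸ memE (1 : Fin 3)) (e1 ▸ tgt (1 : Fin 3))
  have e2 : E 2 = out a f := eq_out ((src (2 : Fin 3)).trans h1) (el (2 : Fin 3))
  obtain ⟨c, h2, hc⟩ := out_mem (e2 ▸ memE (2 : Fin 3)) (e2 ▸ tgt (2 : Fin 3))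
  have hV : ![pt a, cmd a, pt c] = V := by
    funext (x : Fin 3)
    fin_cases x
    exacts [h0.symm, h1.symm, h2.symm]
  refine ⟨a, z, c, ?_, ?_, ?_, hV, ?_⟩
  · cases hsa : s a <;> simp_all [next]
  -- Here injectivity of the match is what separates the two points.
  · rintro rfl
    have h02 : (0 : Fin 3) = 2 := injV (h0.trans h2.symm)
    cases h02
  · rw [hV]
    exact hi
  · funext (x : Fin 3)
    fin_cases x
    exacts [e0.symm, e1.symm, e2.symm]

theorem exists_eq_matchBranch (hs : Good s) {x : EdgeLabel} (hx : x ≠ blank)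
    (g : Net.Match (branchGraph x) (enc s hs)) :
    ∃ (a d : ℕ) (h : (s a).next x = some d),
      (matchBranch hs hx h).V = g.V ∧ (matchBranch hs hx h).E = g.E := by
  obtain ⟨V, E, memV, memE, src, tgt, el, nl, -, -⟩ := g
  dsimp only at *
  change Fin 2 → Name at V
  change Fin 1 → Arrow at E
  obtain ⟨a, h0⟩ := eq_cmd (ne_of_eq_of_ne (nl (0 : Fin 2)) (show decision ≠ point by decide))
  have e0 : E 0 = out a x := eq_out ((src (0 : Fin 1)).trans h0) (el (0 : Fin 1))
  obtain ⟨d, h1, hd⟩ := out_mem (e0 ▸ memE (0 : Fin 1)) (e0 ▸ tgt (0 : Fin 1))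
  refine ⟨a, d, hd, ?_, ?_⟩
  · funext (x : Fin 2)
    fin_cases x
    exacts [h0.symm, h1.symm]
  · funext (x : Fin 1)
    fin_cases x
    exact e0.symm

theorem exists_eq_matchLongBranch (hs : Good s) {x : EdgeLabel} (hx : x ≠ blank)
    (g : Net.Match (longBranchGraph x) (enc s hs)) :
    ∃ (a b d : ℕ) (h : (s a).next x = some b) (hb : s b = stmt d),
      (matchLongBranch hs hx h hb).V = g.V ∧ (matchLongBranch hs hx h hb).E = g.E := by
  obtain ⟨V, E, memV, memE, src, tgt, el, nl, -, -⟩ := g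
  dsimp only at *
  change Fin 4 → Name at V
  change Fin 3 → Arrow at E
  obtain ⟨a, h0⟩ := eq_cmd (ne_of_eq_of_ne (nl (0 : Fin 4)) (show decision ≠ point by decide))
  have e0 : E 0 = out a x := eq_out ((src (0 : Fin 3)).trans h0) (el (0 : Fin 3))
  obtain ⟨b, h2, hb⟩ := out_mem (e0 ▸ memE (0 : Fin 3)) (e0 ▸ tgt (0 : Fin 3))
  have e1 : E 1 = into b := eq_into ((src (1 : Fin 3)).trans h2)
  have h3 : V 3 = cmd b := (tgt (1 : Fin 3)).symm.trans (by rw [e1]; rfl)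
  have e2 : E 2 = out b blank := eq_out ((src (2 : Fin 3)).trans h3) (el (2 : Fin 3))
  obtain ⟨d, h1, hd⟩ := out_mem (e2 ▸ memE (2 : Fin 3)) (e2 ▸ tgt (2 : Fin 3))
  refine ⟨a, b, d, hb, next_blank.1 hd, ?_, ?_⟩
  · funext (x : Fin 4)
    fin_cases x
    exacts [h0.symm, h1.symm, h2.symm, h3.symm]
  · funext (x : Fin 3)
    fin_cases x
    exacts [e0.symm, e1.symm, e2.symm]

/-! ### Three families of rules, and termination -/

instance (r : GRule NodeLabel EdgeLabel) [h : IsEmpty r.K.E] : IsEmpty r.inv.K.E := h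

theorem mem_rules_iff {r : GRule NodeLabel EdgeLabel} :
    r ∈ system.rules ↔ r = seq ∨ (∃ i : Fin 3, (i = 0 ∨ i = 2) ∧ r = decisionRule i) ∨
      ∃ x : EdgeLabel, x ≠ blank ∧ r = branchRule x := by
  constructor
  · rintro (rfl | rfl | rfl | rfl | rfl)
    · exact Or.inl rfl
    · exact Or.inr (Or.inl ⟨0, Or.inl rfl, rfl⟩)
    · exact Or.inr (Or.inl ⟨2, Or.inr rfl, rfl⟩)
    · exact Or.inr (Or.inr ⟨t, by decide, rfl⟩)
    · exact Or.inr (Or.inr ⟨f, by decide, rfl⟩)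
  · rintro (rfl | ⟨i, rfl | rfl, rfl⟩ | ⟨x, hx, rfl⟩)
    · exact Or.inl rfl
    · exact Or.inr (Or.inl rfl)
    · exact Or.inr (Or.inr (Or.inl rfl))
    · cases x
      · exact Or.inr (Or.inr (Or.inr (Or.inl rfl)))
      · exact Or.inr (Or.inr (Or.inr (Or.inr rfl)))
      · exact absurd rfl hx

theorem terminating_inverse : system.inverse.Terminating := by
  rintro ⟨F, hF⟩
  have hlt : ∀ n, Nat.card (F (n + 1)).E < Nat.card (F n).E := by
    intro n
    obtain ⟨_, ⟨r, hr, rfl⟩, h⟩ := hF n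
    rw [mem_rules_iff] at hr
    obtain rfl | ⟨i, -, rfl⟩ | ⟨x, -, rfl⟩ := hr
    · refine h.card_edges_lt ?_
      change Nat.card (Fin 2) < Nat.card (Fin 4)
      simp
    · refine h.card_edges_lt ?_
      change Nat.card (Fin 2) < Nat.card (Fin 3)
      simp
    · refine h.card_edges_lt ?_
      change Nat.card (Fin 1) < Nat.card (Fin 3)
      simp
  exact not_strictAnti_of_wellFoundedLT (fun n => Nat.card (F n).E) (strictAnti_nat_of_succ_lt hlt)

/-- `G` is isomorphic to the graph of the good program `s`. -/
def Represents (s : Prog) (G : LGraph NodeLabel EdgeLabel) : Prop :=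
  ∃ hs : Good s, Iso G (enc s hs).graph

/-! ### Correspondence between graph steps and program reductions -/

namespace Prog

/-- Any edge into a point can be subdivided by a new statement. -/
theorem Good.exists_bypass_eq (hs : Good s) {a d : ℕ} {l : EdgeLabel}
    (h : (s a).next l = some d) :
    ∃ s' b, Good s' ∧ s = Prog.bypass s' b d ∧ s' b = stmt d ∧ OnlyRef s' b a l := by
  -- Finiteness of the program leaves a fresh name for the new point.
  obtain ⟨b, hb⟩ : ∃ b, s b = dead := by
    obtain ⟨b, hb⟩ := hs.finite.exists_notMem
    exact ⟨b, not_not.1 hb⟩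
  have hsb : ∀ x m, (s x).next m ≠ some b := fun x m hx => hs.closed _ _ _ hx hb
  have hab : a ≠ b := by
    rintro rfl
    rw [hb, next_dead] at h
    cases h
  -- `c` is the command at `a` with its `l`-successor replaced by `b` and nothing else changed.
  obtain ⟨c, hc, hc', hcmap⟩ : ∃ c : Cmd, c.next l = some b ∧
      (∀ m, m ≠ l → c.next m = (s a).next m) ∧ c.map (redirect b d) = s a := by
    have hr : ∀ m y, (s a).next m = some y → redirect b d y = y := fun m y hy =>
      redirect_ne d fun hyb => hsb a m (hyb ▸ hy)
    cases hsa : s a with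
    | dead => rw [hsa, next_dead] at h; cases h
    | exit => rw [hsa] at h; cases l <;> cases h
    | stmt y =>
      rw [hsa, next_stmt] at h
      obtain ⟨rfl, rfl⟩ := h
      refine ⟨stmt b, rfl, fun m hm => ?_, by rw [Cmd.map, redirect_self]⟩
      cases m <;> first | rfl | exact absurd rfl hm
    | dec y z =>
      rw [hsa, next_dec] at h
      rcases h with ⟨rfl, rfl⟩ | ⟨rfl, rfl⟩
      · refine ⟨dec b z, rfl, fun m hm => ?_, ?_⟩
        · cases m <;> first | rfl | exact absurd rfl hm
        · rw [Cmd.map, redirect_self, hr f z (by rw [hsa]; rfl)]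
      · refine ⟨dec y b, rfl, fun m hm => ?_, ?_⟩
        · cases m <;> first | rfl | exact absurd rfl hm
        · rw [Cmd.map, redirect_self, hr t y (by rw [hsa]; rfl)]
  let s' : Prog := Function.update (Function.update s a c) b (stmt d)
  have hs'b : s' b = stmt d := Function.update_self ..
  have hs'a : s' a = c := by simp [s', hab]
  have hs'x : ∀ x, x ≠ a → x ≠ b → s' x = s x := fun x hxa hxb => by simp [s', hxa, hxb]
  have hs' : s = Prog.bypass s' b d := by
    funext x
    by_cases hxb : x = b
    · rw [hxb, bypass_self, hb]
    · rw [bypass_ne _ _ hxb]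
      by_cases hxa : x = a
      · rw [hxa, hs'a, hcmap]
      · rw [hs'x x hxa hxb, map_eq_self]
        exact fun m y hy => redirect_ne d fun hyb => hsb x m (hyb ▸ hy)
  have href : (s' a).next l = some b := by rw [hs'a, hc]
  refine ⟨s', b, (hs' ▸ hs : Good (Prog.bypass s' b d)).of_bypass hs'b hab href, hs', hs'b, href,
    fun x m hx => ?_⟩
  by_cases hxb : x = b
  · rw [hxb, hs'b, next_stmt] at hx
    rw [hx.2] at h
    exact absurd h (hsb a l)
  · by_cases hxa : x = a
    · refine ⟨hxa, ?_⟩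
      by_contra hm
      rw [hxa, hs'a, hc' m hm] at hx
      exact hsb a m hx
    · rw [hs'x x hxa hxb] at hx
      exact absurd hx (hsb x m)

/-- Any statement can be replaced by a decision. -/
theorem Good.exists_collapse_eq (hs : Good s) {a c z : ℕ} (h : s a = stmt c)
    (hz : z = a ∨ z = c) : ∃ s', Good s' ∧ s = Prog.collapse s' a c ∧ s' a = dec z c := by
  have heq : s = Prog.collapse (Function.update s a (dec z c)) a c := by
    unfold Prog.collapse
    rw [Function.update_idem, ← h, Function.update_eq_self]
  exact ⟨_, (heq ▸ hs : Good (Prog.collapse _ a c)).of_collapse (Function.update_self ..) hz, heq,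
    Function.update_self ..⟩

theorem OnlyRef.next_bypass {b d a : ℕ} {l : EdgeLabel} (hs : Good s) (hb : s b = stmt d)
    (h : OnlyRef s b a l) : (Prog.bypass s b d a).next l = some d := by
  have hab : a ≠ b := by
    rintro rfl
    have h1 := h.1
    rw [hb, next_stmt] at h1
    exact hs.ne_of_stmt hb h1.2.symm
  rw [next_bypass_of_ne h.1 hab, redirect_self]

end Prog

theorem vec_eq_pt {i : Fin 3} (hi : i = 0 ∨ i = 2) {a c z : ℕ}
    (h : ![pt a, cmd a, pt c] i = pt z) : z = a ∨ z = c := by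
  rcases hi with rfl | rfl
  · left
    cases h
    rfl
  · right
    cases h
    rfl

theorem exists_vec_eq_pt {i : Fin 3} (hi : i = 0 ∨ i = 2) (a c : ℕ) :
    ∃ z, ![pt a, cmd a, pt c] i = pt z := by
  rcases hi with rfl | rfl
  · exact ⟨a, rfl⟩
  · exact ⟨c, rfl⟩

/-- The graphs that are represented by good programs are closed under the rules. -/
theorem Represents.step {G H : LGraph NodeLabel EdgeLabel} (hG : Represents s G)
    (h : system.Step G H) : ∃ s', Represents s' H := by
  obtain ⟨hs, hG⟩ := hG
  obtain ⟨r, hr, h⟩ := h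
  rw [mem_rules_iff] at hr
  obtain rfl | ⟨i, hi, rfl⟩ | ⟨x, hx, rfl⟩ := hr
  · obtain ⟨g, -, hH⟩ := Net.exists_match hG h
    obtain ⟨a, d, had, hV, hE⟩ := exists_eq_matchStmt hs g
    obtain ⟨s', b, hs', heq, hb, href⟩ := hs.exists_bypass_eq (l := blank) (by rw [had]; rfl)
    exact ⟨s', hs', hH _ _ _ hV hE
      (rewrites_seq hs' hs heq (next_blank.1 href.1) hb had href)⟩
  · obtain ⟨g, -, hH⟩ := Net.exists_match hG h
    obtain ⟨a, c, hac, hV, hE⟩ := exists_eq_matchStmt hs g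
    obtain ⟨z, hz⟩ := exists_vec_eq_pt hi a c
    obtain ⟨s', hs', heq, ha⟩ := hs.exists_collapse_eq hac (vec_eq_pt hi hz)
    exact ⟨s', hs', hH _ _ _ hV hE
      (rewrites_decision hs' hs i heq ha (hs.ne_of_stmt hac) hz hac)⟩
  · obtain ⟨g, -, hH⟩ := Net.exists_match hG h
    obtain ⟨a, d, had, hV, hE⟩ := exists_eq_matchBranch hs hx g
    obtain ⟨s', b, hs', heq, hb, href⟩ := hs.exists_bypass_eq had
    exact ⟨s', hs', hH _ _ _ hV hE (rewrites_branch hs' hs hx heq href.1 hb had href)⟩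

/-- Reductions of graphs come from reductions of programs. -/
theorem Represents.inverse_step {G H : LGraph NodeLabel EdgeLabel} (hG : Represents s G)
    (h : system.inverse.Step G H) : ∃ s', Red s s' ∧ Represents s' H := by
  obtain ⟨hs, hG⟩ := hG
  obtain ⟨_, ⟨r, hr, rfl⟩, h⟩ := h
  rw [mem_rules_iff] at hr
  obtain rfl | ⟨i, hi, rfl⟩ | ⟨x, hx, rfl⟩ := hr
  · obtain ⟨g, hg, hH⟩ := Net.exists_match hG h
    obtain ⟨a, b, d, hab, hb, hV, hE⟩ := exists_eq_matchSeq hs g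
    -- The rule deletes the point `b`, so by the dangling condition every edge into it lies in the
    -- match, and `out a blank` is the only matched edge that ends there.
    have href : OnlyRef s b a blank := by
      refine ⟨by rw [hab]; rfl, fun a' l' h' => ?_⟩
      by_cases he : ∀ x, g.E x ≠ out a' l'
      · obtain ⟨z, hz⟩ := hg (out a' l') (Option.isSome_iff_exists.2 ⟨b, h'⟩) he (3 : Fin 5)
          (Or.inr (by rw [← hV]; exact (Arrow.tgt_out h').symm))
        change Fin 3 at z
        fin_cases z <;> cases hz
      · push Not at he
        obtain ⟨x, hx⟩ := he
        rw [← hE] at hx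
        change Fin 4 at x
        fin_cases x
        · cases hx
        · cases hx
          exact ⟨rfl, rfl⟩
        · cases hx
        · cases hx
          rw [hb, next_stmt] at h'
          exact absurd h'.2.symm (hs.ne_of_stmt hb)
    exact ⟨_, .bypass hb href, hs.bypass hb, hH _ (matchSeq hs hab hb) _ hV hE
      (rewrites_seq hs (hs.bypass hb) rfl hab hb (next_blank.1 (href.next_bypass hs hb))
        href).symm⟩
  · obtain ⟨g, -, hH⟩ := Net.exists_match hG h
    obtain ⟨a, z, c, ha, hne, hz, hV, hE⟩ := exists_eq_matchDecision hs i g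
    have hz' := vec_eq_pt hi hz
    exact ⟨_, .collapse ha hz', hs.collapse ha hz', hH _ (matchDecision hs i ha hne hz) _ hV hE
      (rewrites_decision hs (hs.collapse ha hz') i rfl ha hne hz (collapse_self s a c)).symm⟩
  · obtain ⟨g, hg, hH⟩ := Net.exists_match hG h
    obtain ⟨a, b, d, hab, hb, hV, hE⟩ := exists_eq_matchLongBranch hs hx g
    have href : OnlyRef s b a x := by
      refine ⟨hab, fun a' l' h' => ?_⟩
      by_cases he : ∀ y, g.E y ≠ out a' l'
      · obtain ⟨z, hz⟩ := hg (out a' l') (Option.isSome_iff_exists.2 ⟨b, h'⟩) he (2 : Fin 4)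
          (Or.inr (by rw [← hV]; exact (Arrow.tgt_out h').symm))
        change Fin 2 at z
        fin_cases z <;> cases hz
      · push Not at he
        obtain ⟨y, hy⟩ := he
        rw [← hE] at hy
        change Fin 3 at y
        fin_cases y
        · cases hy
          exact ⟨rfl, rfl⟩
        · cases hy
        · cases hy
          rw [hb, next_stmt] at h'
          exact absurd h'.2.symm (hs.ne_of_stmt hb)
    exact ⟨_, .bypass hb href, hs.bypass hb, hH _ (matchLongBranch hs hx hab hb) _ hV hE
      (rewrites_branch hs (hs.bypass hb) hx rfl hab hb (href.next_bypass hs hb) href).symm⟩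

/-- Reductions of programs are reductions of graphs. -/
theorem inverse_step_of_red (hs : Good s) (hs' : Good s') (h : Red s s') :
    system.inverse.Step (enc s hs).graph (enc s' hs').graph := by
  rw [GTSystem.step_inverse_iff]
  cases h with
  | @bypass b d a l hb h =>
    by_cases hl : l = blank
    · subst hl
      refine ⟨seq, mem_rules_iff.2 (Or.inl rfl),
        (rewrites_seq hs hs' rfl (next_blank.1 h.1) hb (next_blank.1 (h.next_bypass hs hb))
          h).directDerives ?_⟩
      -- All nodes on the left of `seq` are interface nodes, so nothing can dangle.
      intro e _ _ (x : Fin 3) _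
      refine ⟨x, ?_⟩
      fin_cases x <;> rfl
    · refine ⟨branchRule l, mem_rules_iff.2 (Or.inr (Or.inr ⟨l, hl, rfl⟩)),
        (rewrites_branch hs hs' hl rfl h.1 hb (h.next_bypass hs hb) h).directDerives ?_⟩
      intro e _ _ (x : Fin 2) _
      refine ⟨x, ?_⟩
      fin_cases x <;> rfl
  | @collapse a z c ha hz =>
    obtain ⟨i, hi, hiz⟩ : ∃ i : Fin 3, (i = 0 ∨ i = 2) ∧ ![pt a, cmd a, pt c] i = pt z := by
      rcases hz with rfl | rfl
      · exact ⟨0, Or.inl rfl, rfl⟩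
      · exact ⟨2, Or.inr rfl, rfl⟩
    have hself := collapse_self s a c
    refine ⟨decisionRule i, mem_rules_iff.2 (Or.inr (Or.inl ⟨i, hi, rfl⟩)),
      (rewrites_decision hs hs' i rfl ha (hs.ne_of_dec ha hz) hiz hself).directDerives ?_⟩
    intro e he hne (x : Fin 3) hx
    fin_cases x
    · exact ⟨(0 : Fin 2), rfl⟩
    -- The deleted node is `cmd a`; its incident edges are `into a` and `out a blank`, both of which
    -- are matched.
    · exfalso
      rcases hx with hx | hx
      · cases e with
        | into y => cases hx
        | out y l =>
          cases hx
          obtain ⟨w, hw⟩ := Option.isSome_iff_exists.1 (he : ((collapse s a c a).next l).isSome)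
          rw [hself, next_stmt] at hw
          obtain ⟨rfl, -⟩ := hw
          exact hne (1 : Fin 2) rfl
      · cases e with
        | into y =>
          cases hx
          exact hne (0 : Fin 2) rfl
        | out y l => cases hx
    · exact ⟨(1 : Fin 2), rfl⟩

theorem represents_start : ∃ s, Represents s grammar.start := by
  let s : Prog := fun x => if x = 0 then stmt 1 else if x = 1 then exit else dead
  have h0 : s 0 = stmt 1 := rfl
  have h1 : s 1 = exit := rfl
  have hx : ∀ x, s x ≠ dead → x = 0 ∨ x = 1 := by
    intro x
    contrapose!
    intro h
    simp [s, h.1, h.2]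
  have hs1 : Halts s 1 := .exit h1
  have hs0 : Halts s 0 := .step (l := blank) (b := 1) (by rw [h0]; rfl) hs1
  have hs : Good s := by
    refine ⟨(Set.toFinite {0, 1}).subset hx, fun a b l h => ?_, fun a ha => ?_⟩
    · have ha : s a ≠ dead := IsCmd.ne_dead (isCmd_of_next (by rw [h]; rfl))
      rcases hx a ha with rfl | rfl
      · rw [h0, next_stmt] at h
        rw [← h.2, h1]
        exact Cmd.noConfusion
      · rw [h1] at h
        cases l <;> cases h
    · rcases hx a ha with rfl | rfl
      · exact hs0
      · exact hs1
  refine ⟨s, hs, (matchStmt hs h0).iso ?_ ?_⟩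
  · rintro (a | a) ha
    · rcases hx a ha with rfl | rfl
      · exact ⟨(0 : Fin 3), rfl⟩
      · exact ⟨(2 : Fin 3), rfl⟩
    · rcases hx a (IsCmd.ne_dead ha) with rfl | rfl
      · exact ⟨(1 : Fin 3), rfl⟩
      · exact absurd ha id
  · rintro (a | ⟨a, l⟩) ha
    · rcases hx a (IsCmd.ne_dead ha) with rfl | rfl
      · exact ⟨(0 : Fin 2), rfl⟩
      · exact absurd ha id
    · rcases hx a (IsCmd.ne_dead (isCmd_of_next ha)) with rfl | rfl
      · cases l
        · cases ha
        · cases ha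
        · exact ⟨(1 : Fin 2), rfl⟩
      · cases l <;> cases ha

/-! ### Confluence on the language -/

theorem Represents.congr {G H : LGraph NodeLabel EdgeLabel} (hG : Represents s G) (h : Iso G H) :
    Represents s H :=
  hG.imp fun _ hG => iso_trans (iso_symm h) hG

theorem exists_represents {G : LGraph NodeLabel EdgeLabel} (h : G.cls ∈ grammar.language) :
    ∃ s, Represents s G :=
  ((GraphGrammar.cls_mem_language_iff rfl).1 h).preserves (P := fun G => ∃ s, Represents s G)
    (fun _ _ hG hGH => hG.imp fun _ hs => hs.congr hGH)
    (fun _ _ ⟨_, hG⟩ hGH => hG.step hGH) represents_start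

theorem Represents.inverse_derives {G H : LGraph NodeLabel EdgeLabel} (hG : Represents s G)
    (h : system.inverse.Derives G H) : ∃ s', Relation.ReflTransGen Red s s' ∧ Represents s' H :=
  h.preserves (P := fun H => ∃ s', Relation.ReflTransGen Red s s' ∧ Represents s' H)
    (fun _ _ ⟨s', hs', hG⟩ hGH => ⟨s', hs', hG.congr hGH⟩)
    (fun _ _ ⟨_, hs', hG⟩ hGH => by
      obtain ⟨s'', hred, hs''⟩ := hG.inverse_step hGH
      exact ⟨s'', hs'.tail hred, hs''⟩)
    ⟨s, .refl, hG⟩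

theorem inverse_derives_of_red (h : Relation.ReflTransGen Red s s')
    {G : LGraph NodeLabel EdgeLabel} (hG : Represents s G) :
    ∃ hs' : Good s', system.inverse.Derives G (enc s' hs').graph := by
  induction h with
  | refl =>
    obtain ⟨hs, hG⟩ := hG
    exact ⟨hs, Or.inl hG⟩
  | tail _ hred ih =>
    obtain ⟨hs, hG⟩ := ih
    exact ⟨hs.red hred, hG.tail (inverse_step_of_red hs _ hred)⟩

theorem confluentOn_inverse : system.inverse.ConfluentOn grammar.language := by
  intro G H₁ H₂ hG h₁ h₂
  obtain ⟨s, hs⟩ := exists_represents hG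
  obtain ⟨s₁, hr₁, hs₁⟩ := hs.inverse_derives h₁
  obtain ⟨s₂, hr₂, hs₂⟩ := hs.inverse_derives h₂
  -- Both sides reach the same program `s₃`, so its graph is a common reduct.
  obtain ⟨s₃, h₁₃, h₂₃⟩ := Red.confluent hs.1 hr₁ hr₂
  obtain ⟨hs₃, hd₁⟩ := inverse_derives_of_red h₁₃ hs₁
  obtain ⟨_, hd₂⟩ := inverse_derives_of_red h₂₃ hs₂
  exact ⟨(enc s₃ hs₃).graph, hd₁, hd₂⟩

end EFD

theorem mainTheorem10 :
    EFD.grammar.system.inverse.EfficientlyRecognises EFD.grammar.terminals EFD.grammar.language :=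
  ⟨GraphGrammar.recognises_inverse rfl, EFD.terminating_inverse, EFD.confluentOn_inverse⟩
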